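/- Let $(\Omega,\mu)$ be a measure space with $\sigma$-finite $\mu$, $E$ a complex Banach space, $1<p<\infty$, $D=L^p_\mu(\Omega,E)$, and let $A=L^\infty_\mu(\Omega,L(E))\subset L(D)$ be the algebra of multiplication operators $(af)(x)=a(x)f(x)$, with the operator norm. Let $G$ be a (discrete) group and let $\alpha_g:\Omega\to\Omega$, $g\in G$, be an action of $G$ by measurable maps preserving the equivalence class of $\mu$. Let $T_g$ be the isometries of $D$ $$(T_gf)(x)=\Big[\frac{d\,\alpha_g\mu}{d\mu}(x)\Big]^{1/p}f(\alpha_g^{-1}(x)),\qquad \alpha_g\mu(\Delta)=\mu(\alpha_g^{-1}(\Delta)),$$ and let $\hat T_g(a)=T_gaT_g^{-1}$. For a subalgebra $A$ of operators and a group of isometries $T_g$, $B(A,T_g)$ denotes the norm-closed algebra of operators generated by $A$ and $\{T_g\}_{g\in G}$. On $H=l^p(G,D)$ put $$(\bar a\xi)(g)=\hat T_g(a)\,\xi(g)\quad(a\in A),\qquad (V_{g_0}\xi)(g)=\xi(gg_0)\quad(g_0\in G),$$ and $\bar A=\{\bar a: a\in A\}$; $B(\bar A,V_g)\subset L(H)$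 is the regular representation. The group $G$ acts *metrically freely* if for every finite set $\{g_1,\dots,g_k\}\subset G$ (of distinct elements) and every measurable $\Delta$ with $\mu(\Delta)>0$ there is a measurable $\Delta'\subset\Delta$ with $\mu(\Delta')>0$ and $\mu(\alpha_{g_i}(\Delta')\cap\alpha_{g_j}(\Delta'))=0$ for $i\ne j$. The group $G$ is *amenable* if there is a translation-invariant mean on $l^\infty(G)$. **Theorem.** If $G$ is amenable and acts metrically freely, then there is an isometric isomorphism of algebras $B(A,T_g)\to B(\bar A,V_g)$ with $a\mapsto\bar a$ for $a\in A$ and $T_g\mapsto V_g$ for $g\in G$. In particular: (*) for every finite sum, $\big\|\sum a_gT_g\big\|\ge\|a_e\|$ ($a_g\in A$, $e$ the identity of $G$); (**) there are continuous linear maps $N_{g_0}:B(A,T_g)\to A$, $g_0\in G$, with $N_{g_0}(\sum a_gT_g)=a_{g_0}$ for every finite sum, and for $b\in B(A,T_g)$ one has $b=0$ if and only if $N_g(b)=0$ for every $g\in G$; (character invariance) for every homomorphism $\chi:G\to\{z\in\mathbb C:|z|=1\}$ and every finite sum, $\big\|\sum a_gT_g\big\|=\big\|\sum a_g\chi(g)T_g\big\|$.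 -/

import Mathlib

open MeasureTheory
open scoped ENNReal

noncomputable section

set_option linter.unusedSectionVars false

namespace AutAlg

/-! ### Banach algebras associated with automorphisms -/

section General

variable {G : Type*} [Group G] {X : Type*} [NormedAddCommGroup X] [NormedSpace ℂ X]

/-- The operator `T_g` as an element of `L(X)`. -/
def op (T : G →* (X ≃ₗᵢ[ℂ] X)) (g : G) : X →L[ℂ] X :=
  ((T g).toContinuousLinearEquiv : X →L[ℂ] X)

@[simp]
theorem op_apply (T : G →* (X ≃ₗᵢ[ℂ] X)) (g : G) (x : X) : op T g x = T g x := rfl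

/-- `B(A, T_g)`: the norm-closed subalgebra of `L(X)` generated by `A` and all `T_g`. -/
def B (A : Subalgebra ℂ (X →L[ℂ] X)) (T : G →* (X ≃ₗᵢ[ℂ] X)) : Subalgebra ℂ (X →L[ℂ] X) :=
  (Algebra.adjoin ℂ ((A : Set (X →L[ℂ] X)) ∪ Set.range (op T))).topologicalClosure

/-- The finite sum `∑ a_g T_g`. -/
def finSum (A : Subalgebra ℂ (X →L[ℂ] X)) (T : G →* (X ≃ₗᵢ[ℂ] X)) (a : G →₀ A) : X →L[ℂ] X :=
  ∑ g ∈ a.support, (a g : X →L[ℂ] X) * op T g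

theorem coeff_mem (A : Subalgebra ℂ (X →L[ℂ] X)) (T : G →* (X ≃ₗᵢ[ℂ] X))
    {a : X →L[ℂ] X} (ha : a ∈ A) : a ∈ B A T :=
  Subalgebra.le_topologicalClosure _ (Algebra.subset_adjoin (Or.inl ha))

theorem op_mem (A : Subalgebra ℂ (X →L[ℂ] X)) (T : G →* (X ≃ₗᵢ[ℂ] X)) (g : G) :
    op T g ∈ B A T :=
  Subalgebra.le_topologicalClosure _ (Algebra.subset_adjoin (Or.inr ⟨g, rfl⟩))

theorem finSum_mem (A : Subalgebra ℂ (X →L[ℂ] X)) (T : G →* (X ≃ₗᵢ[ℂ] X)) (a : G →₀ A) :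
    finSum A T a ∈ B A T :=
  sum_mem fun g _ => mul_mem (coeff_mem A T (a g).2) (op_mem A T g)

/-- Property (*): `‖∑ a_g T_g‖ ≥ ‖a_e‖` for every finite sum. -/
def PropStar (A : Subalgebra ℂ (X →L[ℂ] X)) (T : G →* (X ≃ₗᵢ[ℂ] X)) : Prop :=
  ∀ a : G →₀ A, ‖a 1‖ ≤ ‖finSum A T a‖

/-- `N` is the family of coefficient maps: each `N g₀ : B(A, T_g) → A` is linear and continuous
and sends a finite sum `∑ a_g T_g` to `a_{g₀}`. When `T_g A T_g⁻¹ = A` the finite sums are dense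
in `B(A, T_g)`, so that there is at most one such family. -/
def IsCoeffFamily (A : Subalgebra ℂ (X →L[ℂ] X)) (T : G →* (X ≃ₗᵢ[ℂ] X))
    (N : G → (B A T →L[ℂ] A)) : Prop :=
  ∀ (g₀ : G) (a : G →₀ A), N g₀ ⟨finSum A T a, finSum_mem A T a⟩ = a g₀

/-- Property (**): (*) holds and, for the coefficient maps `N_g : B(A, T_g) → A`, an element `b`
is zero iff all its coefficients `N_g(b)` are zero. -/
def PropStarStar (A : Subalgebra ℂ (X →L[ℂ] X)) (T : G →* (X ≃ₗᵢ[ℂ] X)) : Prop :=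
  PropStar A T ∧
    ∃ N : G → (B A T →L[ℂ] A), IsCoeffFamily A T N ∧ ∀ b : B A T, b = 0 ↔ ∀ g, N g b = 0

/-- Invariance under characters `χ` of the (discrete) group `G`:
`‖∑ a_g T_g‖ = ‖∑ a_g χ(g) T_g‖` for every finite sum. -/
def CharInvariant (A : Subalgebra ℂ (X →L[ℂ] X)) (T : G →* (X ≃ₗᵢ[ℂ] X)) : Prop :=
  ∀ (χ : G →* Circle) (a : G →₀ A),
    ‖finSum A T a‖ = ‖∑ g ∈ a.support, (χ g : ℂ) • ((a g : X →L[ℂ] X) * op T g)‖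

/-- The automorphism `T̂_g(a) = T_g a T_g⁻¹`. -/
def hat (T : G →* (X ≃ₗᵢ[ℂ] X)) (g : G) (a : X →L[ℂ] X) : X →L[ℂ] X :=
  op T g * a * op T g⁻¹

theorem hat_apply (T : G →* (X ≃ₗᵢ[ℂ] X)) (g : G) (a : X →L[ℂ] X) (x : X) :
    hat T g a x = T g (a ((T g)⁻¹ x)) := by
  simp [hat]

theorem norm_hat_le (T : G →* (X ≃ₗᵢ[ℂ] X)) (g : G) (a : X →L[ℂ] X) :
    ‖hat T g a‖ ≤ ‖a‖ := by
  refine ContinuousLinearMap.opNorm_le_bound _ (norm_nonneg _) fun x => ?_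
  rw [hat_apply, LinearIsometryEquiv.norm_map]
  refine (a.le_opNorm _).trans_eq ?_
  rw [← LinearIsometryEquiv.norm_map (T g)⁻¹ x]

/-! ### The regular representation -/

variable (p : ℝ≥0∞) [Fact (1 ≤ p)]

/-- The operator `(ā ξ)(g) = T̂_g(a) ξ(g)` on `ℓ^p(G, X)`, as an algebra homomorphism in `a`. -/
def bar (T : G →* (X ≃ₗᵢ[ℂ] X)) :
    (X →L[ℂ] X) →ₐ[ℂ] (lp (fun _ : G => X) p →L[ℂ] lp (fun _ : G => X) p) where
  toFun a := lp.mapCLM p (fun g => hat T g a) (norm_nonneg a) fun g => norm_hat_le T g a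
  map_one' := by ext ξ g; simp [hat_apply]
  map_mul' a b := by ext ξ g; simp [hat_apply]
  map_zero' := by ext ξ g; simp [hat_apply]
  map_add' a b := by ext ξ g; simp [hat_apply]
  commutes' c := by ext ξ g; simp [hat_apply, Algebra.algebraMap_eq_smul_one]

@[simp]
theorem bar_apply (T : G →* (X ≃ₗᵢ[ℂ] X)) (a : X →L[ℂ] X) (ξ : lp (fun _ : G => X) p) (g : G) :
    bar p T a ξ g = hat T g a (ξ g) := rfl

/-- The algebra `Ā` of all `ā`, `a ∈ A`. -/
def barAlg (A : Subalgebra ℂ (X →L[ℂ] X)) (T : G →* (X ≃ₗᵢ[ℂ] X)) :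
    Subalgebra ℂ (lp (fun _ : G => X) p →L[ℂ] lp (fun _ : G => X) p) :=
  A.map (bar p T)

theorem bar_mem (A : Subalgebra ℂ (X →L[ℂ] X)) (T : G →* (X ≃ₗᵢ[ℂ] X)) {a : X →L[ℂ] X}
    (ha : a ∈ A) : bar p T a ∈ barAlg p A T := ⟨a, ha, rfl⟩

theorem memlp_comp_equiv (σ : G ≃ G) (ξ : lp (fun _ : G => X) p) :
    Memℓp (fun g => ξ (σ g)) p := by
  have h := lp.memℓp ξ
  rcases p.trichotomy with rfl | rfl | hp
  · exact absurd (Fact.out : (1 : ℝ≥0∞) ≤ 0) (by simp)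
  · rw [memℓp_infty_iff] at h ⊢
    refine h.mono ?_
    rintro _ ⟨g, rfl⟩
    exact ⟨σ g, rfl⟩
  · rw [memℓp_gen_iff hp] at h ⊢
    exact h.comp_injective σ.injective

theorem norm_comp_equiv (σ : G ≃ G) (ξ : lp (fun _ : G => X) p) :
    ‖(⟨fun g => ξ (σ g), memlp_comp_equiv p σ ξ⟩ : lp (fun _ : G => X) p)‖ = ‖ξ‖ := by
  rcases p.trichotomy with rfl | rfl | hp
  · exact absurd (Fact.out : (1 : ℝ≥0∞) ≤ 0) (by simp)
  · rw [lp.norm_eq_ciSup, lp.norm_eq_ciSup]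
    exact σ.iSup_comp (g := fun g => ‖ξ g‖)
  · rw [lp.norm_eq_tsum_rpow hp, lp.norm_eq_tsum_rpow hp]
    congr 1
    exact σ.tsum_eq fun g => ‖ξ g‖ ^ p.toReal

variable (X) in
/-- The operators `(V_{g₀} ξ)(g) = ξ(g g₀)` on `ℓ^p(G, X)`. -/
def V : G →* (lp (fun _ : G => X) p ≃ₗᵢ[ℂ] lp (fun _ : G => X) p) where
  toFun g₀ :=
    { toFun := fun ξ => ⟨fun g => ξ (g * g₀), memlp_comp_equiv p (Equiv.mulRight g₀) ξ⟩
      invFun := fun ξ => ⟨fun g => ξ (g * g₀⁻¹), memlp_comp_equiv p (Equiv.mulRight g₀⁻¹) ξ⟩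
      map_add' := fun ξ η => by ext g; rfl
      map_smul' := fun c ξ => by ext g; rfl
      left_inv := fun ξ => by ext g; simp
      right_inv := fun ξ => by ext g; simp
      norm_map' := fun ξ => norm_comp_equiv p (Equiv.mulRight g₀) ξ }
  map_one' := by
    ext ξ g
    change ξ (g * 1) = ξ g
    rw [mul_one]
  map_mul' g h := by
    ext ξ k
    change ξ (k * (g * h)) = ξ (k * g * h)
    rw [mul_assoc]

@[simp]
theorem V_apply (g₀ : G) (ξ : lp (fun _ : G => X) p) (g : G) : V X p g₀ ξ g = ξ (g * g₀) := rfl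

end General

/-- A (discrete) group is amenable if `ℓ^∞(G)` carries a translation invariant mean, that is, a
positive normalised linear functional `m` with `m(f(s ·)) = m(f)` for all `s ∈ G`. -/
def IsAmenable (G : Type*) [Group G] : Prop :=
  ∃ m : lp (fun _ : G => ℝ) ∞ →ₗ[ℝ] ℝ,
    (∀ f, (∀ x, 0 ≤ f x) → 0 ≤ m f) ∧ m 1 = 1 ∧
      ∀ (s : G) (f f' : lp (fun _ : G => ℝ) ∞), (∀ x, f' x = f (s * x)) → m f' = m f

/-! ### Multiplication and weighted composition operators in `L^p(Ω, E)` -/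

section Lebesgue

variable {Ω : Type*} [MeasurableSpace Ω] {E : Type*} [NormedAddCommGroup E] [NormedSpace ℂ E]

section Mult

variable (μ : Measure Ω) (p : ℝ≥0∞) [Fact (1 ≤ p)]

/-- The operator of multiplication by `a ∈ L^∞(Ω, L(E))` on `L^p(Ω, E)`:
`(a f)(x) = a(x) f(x)`. -/
def mulOp : Lp (E →L[ℂ] E) ∞ μ →L[ℂ] (Lp E p μ →L[ℂ] Lp E p μ) :=
  (ContinuousLinearMap.id ℂ (E →L[ℂ] E)).holderL μ ∞ p p

theorem mulOp_coe (a : Lp (E →L[ℂ] E) ∞ μ) (f : Lp E p μ) :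
    mulOp μ p a f =ᵐ[μ] fun x => a x (f x) :=
  ContinuousLinearMap.coeFn_holder _ a f

variable (E) in
/-- The algebra `A = L^∞(Ω, L(E)) ⊂ L(L^p(Ω, E))` of all multiplication operators. -/
def multAlg : Subalgebra ℂ (Lp E p μ →L[ℂ] Lp E p μ) where
  carrier := Set.range (mulOp μ p)
  mul_mem' := by
    rintro _ _ ⟨a, rfl⟩ ⟨b, rfl⟩
    refine ⟨(ContinuousLinearMap.compL ℂ E E E).holder ∞ a b, ?_⟩
    ext1 f
    refine Lp.ext ?_
    rw [mul_apply_eq_comp]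
    filter_upwards [mulOp_coe μ p ((ContinuousLinearMap.compL ℂ E E E).holder ∞ a b) f,
      (ContinuousLinearMap.compL ℂ E E E).coeFn_holder (r := ∞) a b,
      mulOp_coe μ p a (mulOp μ p b f), mulOp_coe μ p b f] with x h1 h2 h3 h4
    rw [h1, h2, h3, h4]
    rfl
  add_mem' := by
    rintro _ _ ⟨a, rfl⟩ ⟨b, rfl⟩
    exact ⟨a + b, map_add _ _ _⟩
  algebraMap_mem' c := by
    refine ⟨(memLp_top_const (c • ContinuousLinearMap.id ℂ E)).toLp _, ?_⟩
    ext1 f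
    refine Lp.ext ?_
    rw [Algebra.algebraMap_eq_smul_one]
    filter_upwards [mulOp_coe μ p ((memLp_top_const (c • ContinuousLinearMap.id ℂ E)).toLp _) f,
      MemLp.coeFn_toLp (memLp_top_const (μ := μ) (c • ContinuousLinearMap.id ℂ E)),
      Lp.coeFn_smul c f] with x h1 h2 h3
    rw [h1, h2]
    exact h3.symm

theorem mulOp_mem (a : Lp (E →L[ℂ] E) ∞ μ) : mulOp μ p a ∈ multAlg E μ p := ⟨a, rfl⟩

end Mult

section Action

variable {G : Type*} [Group G] [MulAction G Ω]

/-- The maps `α_g : x ↦ g • x` are measurable and preserve the equivalence class of `μ`, that is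
`μ(Δ) = 0` implies `μ(α_g⁻¹(Δ)) = 0` (and conversely, by the same for `g⁻¹`). -/
def PreservesClass (G : Type*) [Group G] [MulAction G Ω] (μ : Measure Ω) : Prop :=
  ∀ g : G, Measure.QuasiMeasurePreserving (fun x : Ω => g • x) μ μ

/-- Metrically free action on the measurable sets modulo null sets. -/
def MetricallyFree (G : Type*) [Group G] [MulAction G Ω] (μ : Measure Ω) : Prop :=
  ∀ (F : Finset G) (Δ : Set Ω), MeasurableSet Δ → 0 < μ Δ →
    ∃ Δ' : Set Ω, MeasurableSet Δ' ∧ 0 < μ Δ' ∧ Δ' ⊆ Δ ∧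
      ∀ g ∈ F, ∀ h ∈ F, g ≠ h →
        μ (((fun x : Ω => g • x) '' Δ') ∩ ((fun x : Ω => h • x) '' Δ')) = 0

/-- The Radon–Nikodym derivative of the image measure `Δ ↦ μ(α_g⁻¹(Δ))` with respect to `μ`. -/
def density (μ : Measure Ω) (g : G) : Ω → ℝ≥0∞ :=
  (μ.map fun x : Ω => g • x).rnDeriv μ

theorem measurable_density (μ : Measure Ω) (g : G) : Measurable (density μ g) :=
  Measure.measurable_rnDeriv _ _

variable {μ : Measure Ω} [SigmaFinite μ]

theorem sigmaFinite_map_smul (hα : PreservesClass G μ) (g : G) :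
    SigmaFinite (μ.map fun x : Ω => g • x) :=
  MeasurableEquiv.sigmaFinite_map
    (f := (⟨MulAction.toPerm g, (hα g).measurable, (hα g⁻¹).measurable⟩ : Ω ≃ᵐ Ω))

theorem density_ne_top (hα : PreservesClass G μ) (g : G) : ∀ᵐ x ∂μ, density μ g x ≠ ∞ := by
  have := sigmaFinite_map_smul hα g
  filter_upwards [Measure.rnDeriv_lt_top (μ.map fun x : Ω => g • x) μ] with x hx using hx.ne

theorem withDensity_density (hα : PreservesClass G μ) (g : G) :
    μ.withDensity (density μ g) = μ.map fun x : Ω => g • x := by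
  have := sigmaFinite_map_smul hα g
  exact Measure.withDensity_rnDeriv_eq _ _ (hα g).absolutelyContinuous

theorem density_one : density μ (1 : G) =ᵐ[μ] fun _ => 1 := by
  have h : (μ.map fun x : Ω => (1 : G) • x) = μ := by simp
  rw [density, h]
  exact Measure.rnDeriv_self μ

theorem density_mul (hα : PreservesClass G μ) (g h : G) :
    density μ (g * h) =ᵐ[μ] fun x => density μ g x * density μ h (g⁻¹ • x) := by
  have hm : Measurable fun x : Ω => density μ h (g⁻¹ • x) :=
    (measurable_density μ h).comp (hα g⁻¹).measurable
  have key : (μ.map fun x : Ω => (g * h) • x) =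
      μ.withDensity (fun x => density μ g x * density μ h (g⁻¹ • x)) := by
    have e1 : (μ.map fun x : Ω => (g * h) • x) =
        (μ.map fun x : Ω => h • x).map fun x : Ω => g • x := by
      rw [Measure.map_map (hα g).measurable (hα h).measurable]
      simp [Function.comp_def, mul_smul]
    rw [e1, ← withDensity_density hα h]
    ext s hs
    rw [Measure.map_apply (hα g).measurable hs,
      withDensity_apply _ ((hα g).measurable hs), withDensity_apply _ hs]
    have e2 := withDensity_mul μ (measurable_density μ g) hm
    have e3 : ∫⁻ x in s, density μ g x * density μ h (g⁻¹ • x) ∂μ =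
        (μ.withDensity (density μ g * fun x => density μ h (g⁻¹ • x))) s := by
      rw [withDensity_apply _ hs]; rfl
    rw [e3, e2, withDensity_density hα g, withDensity_apply _ hs,
      setLIntegral_map hs hm (hα g).measurable]
    simp
  rw [density, key]
  exact Measure.rnDeriv_withDensity μ ((measurable_density μ g).mul hm)

variable (p : ℝ≥0∞) [Fact (1 ≤ p)]

/-- The weight `[dα_g(μ)/dμ]^{1/p}`. -/
def weight (μ : Measure Ω) (g : G) (x : Ω) : ℝ := (density μ g x).toReal ^ (1 / p.toReal)

/-- The function `x ↦ [dα_g(μ)/dμ]^{1/p}(x) f(α_g⁻¹(x))`. -/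
def wcFun (μ : Measure Ω) (g : G) (f : Ω → E) (x : Ω) : E :=
  (weight p μ g x : ℂ) • f (g⁻¹ • x)

theorem wcFun_congr (hα : PreservesClass G μ) (g : G) {f f' : Ω → E} (h : f =ᵐ[μ] f') :
    wcFun p μ g f =ᵐ[μ] wcFun p μ g f' := by
  filter_upwards [(hα g⁻¹).ae_eq_comp h] with x hx
  have hx' : f (g⁻¹ • x) = f' (g⁻¹ • x) := hx
  simp only [wcFun, hx']

theorem aestronglyMeasurable_wcFun (hα : PreservesClass G μ) (g : G) {f : Ω → E}
    (hf : AEStronglyMeasurable f μ) : AEStronglyMeasurable (wcFun p μ g f) μ := by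
  have h1 : Measurable fun x => (weight p μ g x : ℂ) :=
    Complex.measurable_ofReal.comp ((measurable_density μ g).ennreal_toReal.pow_const _)
  exact h1.aestronglyMeasurable.smul (hf.comp_quasiMeasurePreserving (hα g⁻¹))

theorem eLpNorm_wcFun (hα : PreservesClass G μ) (g : G) {f : Ω → E}
    (hf : AEStronglyMeasurable f μ) : eLpNorm (wcFun p μ g f) p μ = eLpNorm f p μ := by
  have hp0 : p ≠ 0 := (zero_lt_one.trans_le (Fact.out : 1 ≤ p)).ne'
  have hinv : ∀ φ : Ω → E, (fun x => φ (g⁻¹ • x)) ∘ (fun x : Ω => g • x) = φ := by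
    intro φ; ext x; simp
  have hmeas : AEStronglyMeasurable (fun x => f (g⁻¹ • x)) (μ.map fun x : Ω => g • x) :=
    (hf.comp_quasiMeasurePreserving (hα g⁻¹)).mono_ac (hα g).absolutelyContinuous
  have hmap : eLpNorm (fun x => f (g⁻¹ • x)) p (μ.map fun x : Ω => g • x) = eLpNorm f p μ := by
    rw [eLpNorm_map_measure hmeas (hα g).measurable.aemeasurable, hinv]
  by_cases hp : p = ∞
  · subst hp
    have h1 : wcFun ∞ μ g f = fun x => f (g⁻¹ • x) := by
      ext x; simp [wcFun, weight]
    rw [h1, ← hmap, eLpNorm_exponent_top, eLpNorm_exponent_top]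
    have hac : μ ≪ μ.map fun x : Ω => g • x := by
      intro s hs
      obtain ⟨t, hst, htm, ht⟩ := exists_measurable_superset_of_null hs
      rw [Measure.map_apply (hα g).measurable htm] at ht
      have h2 := (hα g⁻¹).preimage_null ht
      refine measure_mono_null hst ?_
      convert h2 using 2
      ext x; simp
    exact le_antisymm (eLpNormEssSup_mono_measure _ hac)
      (eLpNormEssSup_mono_measure _ (hα g).absolutelyContinuous)
  · have hpt : 0 < p.toReal := ENNReal.toReal_pos hp0 hp
    rw [← hmap, eLpNorm_eq_lintegral_rpow_enorm_toReal hp0 hp,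
      eLpNorm_eq_lintegral_rpow_enorm_toReal hp0 hp]
    congr 1
    have hm2 : AEStronglyMeasurable (fun x => f (g⁻¹ • x)) μ :=
      hf.comp_quasiMeasurePreserving (hα g⁻¹)
    rw [← withDensity_density hα g, lintegral_withDensity_eq_lintegral_mul₀ (measurable_density μ g).aemeasurable
      (hm2.enorm.pow_const _)]
    refine lintegral_congr_ae ?_
    filter_upwards [density_ne_top hα g] with x hx
    have hw : ‖(weight p μ g x : ℂ)‖ₑ ^ p.toReal = density μ g x := by
      have h0 : (0 : ℝ) ≤ (density μ g x).toReal := ENNReal.toReal_nonneg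
      rw [weight, ← ofReal_norm, Complex.norm_real, Real.norm_of_nonneg (Real.rpow_nonneg h0 _),
        ENNReal.ofReal_rpow_of_nonneg (Real.rpow_nonneg h0 _) hpt.le, ← Real.rpow_mul h0,
        one_div, inv_mul_cancel₀ hpt.ne', Real.rpow_one, ENNReal.ofReal_toReal hx]
    simp only [wcFun, enorm_smul, ENNReal.mul_rpow_of_nonneg _ _ hpt.le, hw, Pi.mul_apply]

theorem memLp_wcFun (hα : PreservesClass G μ) (g : G) {f : Ω → E} (hf : MemLp f p μ) :
    MemLp (wcFun p μ g f) p μ :=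
  ⟨aestronglyMeasurable_wcFun p hα g hf.1, by rw [eLpNorm_wcFun p hα g hf.1]; exact hf.2⟩

/-- `T_g` as a map on `L^p(Ω, E)`. -/
def wcMap (hα : PreservesClass G μ) (g : G) (f : Lp E p μ) : Lp E p μ :=
  (memLp_wcFun p hα g (Lp.memLp f)).toLp _

theorem wcMap_coe (hα : PreservesClass G μ) (g : G) (f : Lp E p μ) :
    wcMap p hα g f =ᵐ[μ] fun x => (weight p μ g x : ℂ) • f (g⁻¹ • x) :=
  MemLp.coeFn_toLp _

theorem wcMap_one (hα : PreservesClass G μ) (f : Lp E p μ) : wcMap p hα (1 : G) f = f := by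
  refine Lp.ext ?_
  filter_upwards [wcMap_coe p hα (1 : G) f, density_one (μ := μ) (G := G)] with x h1 h2
  rw [h1]
  simp [weight, h2]

theorem wcMap_mul (hα : PreservesClass G μ) (g h : G) (f : Lp E p μ) :
    wcMap p hα (g * h) f = wcMap p hα g (wcMap p hα h f) := by
  refine Lp.ext ?_
  filter_upwards [wcMap_coe p hα (g * h) f, density_mul hα g h,
    wcMap_coe p hα g (wcMap p hα h f), (hα g⁻¹).ae_eq_comp (wcMap_coe p hα h f)] with x h1 h2 h3 h4
  have h4' : wcMap p hα h f (g⁻¹ • x) =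
      (weight p μ h (g⁻¹ • x) : ℂ) • f (h⁻¹ • g⁻¹ • x) := h4
  rw [h1, h3, h4', smul_smul, mul_inv_rev, mul_smul, ← Complex.ofReal_mul]
  congr 2
  simp only [weight]
  rw [h2, ENNReal.toReal_mul, Real.mul_rpow ENNReal.toReal_nonneg ENNReal.toReal_nonneg]

variable (E) in
/-- The group of isometries `(T_g f)(x) = [dα_g(μ)/dμ]^{1/p}(x) f(α_g⁻¹(x))` of `L^p(Ω, E)`. -/
def weightedComp (hα : PreservesClass G μ) : G →* (Lp E p μ ≃ₗᵢ[ℂ] Lp E p μ) where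
  toFun g :=
    { toFun := wcMap p hα g
      invFun := wcMap p hα g⁻¹
      map_add' := fun f f' => by
        refine Lp.ext ?_
        filter_upwards [wcMap_coe p hα g (f + f'), wcMap_coe p hα g f, wcMap_coe p hα g f',
          Lp.coeFn_add (wcMap p hα g f) (wcMap p hα g f'),
          (hα g⁻¹).ae_eq_comp (Lp.coeFn_add f f')] with x h1 h2 h3 h4 h5
        have h5' : (f + f') (g⁻¹ • x) = f (g⁻¹ • x) + f' (g⁻¹ • x) := h5
        rw [h1, h4, Pi.add_apply, h2, h3, h5', smul_add]
      map_smul' := fun c f => by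
        refine Lp.ext ?_
        filter_upwards [wcMap_coe p hα g (c • f), wcMap_coe p hα g f,
          Lp.coeFn_smul c (wcMap p hα g f),
          (hα g⁻¹).ae_eq_comp (Lp.coeFn_smul c f)] with x h1 h2 h3 h4
        have h4' : (c • f) (g⁻¹ • x) = c • f (g⁻¹ • x) := h4
        rw [h1, RingHom.id_apply, h3, Pi.smul_apply, h2, h4', smul_comm]
      left_inv := fun f => by rw [← wcMap_mul, inv_mul_cancel, wcMap_one]
      right_inv := fun f => by rw [← wcMap_mul, mul_inv_cancel, wcMap_one]
      norm_map' := fun f => by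
        change ‖wcMap p hα g f‖ = ‖f‖
        rw [wcMap, Lp.norm_toLp, eLpNorm_wcFun p hα g (Lp.aestronglyMeasurable f), Lp.norm_def] }
  map_one' := by
    ext1 f
    exact wcMap_one p hα f
  map_mul' g h := by
    ext1 f
    exact wcMap_mul p hα g h f

theorem weightedComp_coe (hα : PreservesClass G μ) (g : G) (f : Lp E p μ) :
    weightedComp E p hα g f =ᵐ[μ] fun x => (weight p μ g x : ℂ) • f (g⁻¹ • x) :=
  wcMap_coe p hα g f

end Action

end Lebesgue

end AutAlg

end

/-!
Write `b = ∑ a_g T_g` for a finite sum, and `R(b) = ∑ ā_g V_g` for the corresponding operator on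
`ℓ^p(G, L^p(Ω, E))`. Everything rests on the equality `‖b‖ = ‖R(b)‖`.

*Amenability gives* `‖b‖ ≤ ‖R(b)‖` (`norm_sum_le_norm_regSum`). On vectors `h ↦ φ(h) T_h x` one has
`(R(b) ξ)(h) = ∑ φ(hg) T_h a_g T_g x`, which for an almost right-invariant unit vector
`φ ∈ ℓ^p(G)` is close to `φ(h) T_h (b x)`, a vector of norm `‖b x‖`. Such `φ` are `p`-th roots of
almost invariant unit vectors of `ℓ^1(G)`, which exist by the Hahn–Banach theorem and the
invariant mean (`IsAmenable.exists_almost_invariant`).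

*Freeness gives* `‖R(b)‖ ≤ ‖b‖` (`norm_regSum_le`). Let `ξ` be finitely supported in `G`. If the
translates of `Δ` by the finitely many relevant group elements are disjoint, then
`ξ ↦ ∑ T_k⁻¹ ξ(k)` is isometric on vectors living over `Δ` and intertwines `R(b)` with `b`
(`sum_apply_sum_inv`, `enorm_sum_weightedComp_cut_rpow`), so that the estimate holds over `Δ`. Since
`R(b)` commutes with multiplication by indicator functions and every set of positive measure
contains such a `Δ`, the estimate holds pointwise almost everywhere in `Ω`
(`ae_le_of_exists_setLIntegral_le`) and can be integrated.

Given the equality of norms, the isomorphism has as its graph the closure of the algebra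
generated by the pairs `(a, ā)` and `(T_g, V_g)` (`exists_isometric_algEquiv`). The coefficient
`N_g(b)` is the matrix entry of the image of `b` in row `e` and column `g`; it lies in `A` because
`A` is closed, the embedding `L^∞(Ω, L(E)) → L(L^p(Ω, E))` being bounded below
(`norm_le_norm_mulOp`). All other matrix entries are conjugates of these, so `b` is determined by
its coefficients. Finally, a character acts on the finite sums in the regular representation as
conjugation by a multiplication operator on `ℓ^p` (`norm_regSum_character`).
-/

open MeasureTheory
open scoped ENNReal

noncomputable section

namespace AutAlg

/-! ### Isometric isomorphisms from norm equalities on generators -/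

section ClosedGraph

variable {R S : Type*} [NormedRing R] [NormedAlgebra ℂ R] [NormedRing S] [NormedAlgebra ℂ S]

theorem norm_fst_eq_norm_snd_of_mem_closure {P : Set (R × S)}
    (h : ∀ x ∈ Algebra.adjoin ℂ P, ‖x.1‖ = ‖x.2‖) {x : R × S}
    (hx : x ∈ (Algebra.adjoin ℂ P).topologicalClosure) : ‖x.1‖ = ‖x.2‖ := by
  have hc : IsClosed {x : R × S | ‖x.1‖ = ‖x.2‖} :=
    isClosed_eq continuous_fst.norm continuous_snd.norm
  exact closure_minimal (s := (Algebra.adjoin ℂ P : Set (R × S))) h hc hx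

/-- An algebra homomorphism that is isometric on the closed subalgebra generated by `P` maps it
onto the closed subalgebra generated by the image of `P`: the image is complete, hence closed. -/
theorem exists_algEquiv_adjoin_closure {Q R' : Type*} [NormedRing Q] [NormedAlgebra ℂ Q]
    [CompleteSpace Q] [NormedRing R'] [NormedAlgebra ℂ R']
    {P : Set Q} {U : Set R'} (π : Q →ₐ[ℂ] R') (hU : π '' P = U) (hπ : Continuous π)
    (hnorm : ∀ x ∈ (Algebra.adjoin ℂ P).topologicalClosure, ‖π x‖ = ‖x‖) :
    ∃ e : (Algebra.adjoin ℂ P).topologicalClosure ≃ₐ[ℂ] (Algebra.adjoin ℂ U).topologicalClosure,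
      ∀ x, (e x : R') = π x := by
  subst hU
  set C := (Algebra.adjoin ℂ P).topologicalClosure with hC
  have hiso : Isometry (fun x : C => π x) := by
    refine Isometry.of_dist_eq fun x y => ?_
    rw [dist_eq_norm, ← map_sub, hnorm _ (sub_mem x.2 y.2), ← dist_eq_norm]
    rfl
  have hmem : ∀ x : C, π x ∈ (Algebra.adjoin ℂ (π '' P)).topologicalClosure := by
    have : C ≤ (Algebra.adjoin ℂ (π '' P)).topologicalClosure.comap π := by
      refine Subalgebra.topologicalClosure_minimal ?_ ?_
      · rw [← Subalgebra.map_le, AlgHom.map_adjoin]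
        exact Subalgebra.le_topologicalClosure _
      · exact (Subalgebra.isClosed_topologicalClosure _).preimage hπ
    exact fun x => this x.2
  have hsurj : (Algebra.adjoin ℂ (π '' P)).topologicalClosure ≤ C.map π := by
    refine Subalgebra.topologicalClosure_minimal ?_ ?_
    · rw [← AlgHom.map_adjoin]
      exact Subalgebra.map_mono (Subalgebra.le_topologicalClosure _)
    · have hcl : IsClosed (C : Set Q) := Subalgebra.isClosed_topologicalClosure _
      have : CompleteSpace C := hcl.completeSpace_coe
      convert hiso.isClosedEmbedding.isClosed_range using 1
      ext y
      simp only [Subalgebra.coe_map, Set.mem_image, SetLike.mem_coe, Set.mem_range,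
        Subtype.exists, exists_prop]
  refine ⟨AlgEquiv.ofBijective ((π.comp C.val).codRestrict _ hmem) ⟨?_, ?_⟩, fun x => rfl⟩
  · intro x y hxy
    exact hiso.injective (congrArg Subtype.val hxy)
  · rintro ⟨y, hy⟩
    obtain ⟨x, hx, hxy⟩ := hsurj hy
    exact ⟨⟨x, hx⟩, Subtype.ext hxy⟩

/-- If the two coordinates of every element of the algebra generated by `P ⊆ R × S` have the same
norm, then `P` is the graph on generators of an isometric isomorphism between the closed algebras
generated by its two projections. The closure of the generated algebra is the graph. -/
theorem exists_isometric_algEquiv [CompleteSpace R] [CompleteSpace S] {P : Set (R × S)}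
    {U : Set R} {W : Set S}
    (hU : Prod.fst '' P = U) (hW : Prod.snd '' P = W)
    (h : ∀ x ∈ Algebra.adjoin ℂ P, ‖x.1‖ = ‖x.2‖) :
    ∃ Φ : (Algebra.adjoin ℂ U).topologicalClosure ≃ₐ[ℂ] (Algebra.adjoin ℂ W).topologicalClosure,
      Isometry Φ ∧ ∀ x ∈ P, ∀ (u : (Algebra.adjoin ℂ U).topologicalClosure),
        (u : R) = x.1 → (Φ u : S) = x.2 := by
  have hn := fun x hx => norm_fst_eq_norm_snd_of_mem_closure (x := x) h hx
  have hn1 : ∀ x ∈ (Algebra.adjoin ℂ P).topologicalClosure, ‖AlgHom.fst ℂ R S x‖ = ‖x‖ :=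
    fun x hx => by rw [Prod.norm_def, ← hn x hx, max_self]; rfl
  have hn2 : ∀ x ∈ (Algebra.adjoin ℂ P).topologicalClosure, ‖AlgHom.snd ℂ R S x‖ = ‖x‖ :=
    fun x hx => by rw [Prod.norm_def, hn x hx, max_self]; rfl
  obtain ⟨e₁, he₁⟩ := exists_algEquiv_adjoin_closure (AlgHom.fst ℂ R S) hU continuous_fst hn1
  obtain ⟨e₂, he₂⟩ := exists_algEquiv_adjoin_closure (AlgHom.snd ℂ R S) hW continuous_snd hn2
  refine ⟨e₁.symm.trans e₂, ?_, ?_⟩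
  · refine AddMonoidHomClass.isometry_of_norm _ fun u => ?_
    obtain ⟨c, rfl⟩ := e₁.surjective u
    rw [AlgEquiv.trans_apply, AlgEquiv.symm_apply_apply]
    change ‖(e₂ c : S)‖ = ‖(e₁ c : R)‖
    rw [he₁, he₂, hn1 _ c.2, hn2 _ c.2]
  · intro x hx u hu
    have hx' : x ∈ (Algebra.adjoin ℂ P).topologicalClosure :=
      Subalgebra.le_topologicalClosure _ (Algebra.subset_adjoin hx)
    obtain rfl : u = e₁ ⟨x, hx'⟩ := Subtype.ext (by rw [hu, he₁]; rfl)
    rw [AlgEquiv.trans_apply, AlgEquiv.symm_apply_apply, he₂]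
    rfl

end ClosedGraph

/-! ### Finite sums and the regular representation -/

section FiniteSums

variable {G : Type*} [Group G]

/-- If the `y g` normalise the image of `j`, the algebra generated by both consists of the finite
sums `∑ j(a_g) y_g`. -/
theorem exists_finsupp_sum_of_mem_adjoin {R A : Type*} [Ring R] [Algebra ℂ R] [Ring A]
    [Algebra ℂ A] (j : A →ₐ[ℂ] R) (y : G →* R) (h : ∀ g a, ∃ a', y g * j a = j a' * y g)
    {x : R} (hx : x ∈ Algebra.adjoin ℂ (Set.range j ∪ Set.range y)) :
    ∃ a : G →₀ A, x = a.sum fun g c => j c * y g := by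
  have hz : ∀ g, j 0 * y g = 0 := fun g => by rw [map_zero, zero_mul]
  have hadd : ∀ a b : G →₀ A, ((a + b).sum fun g c => j c * y g) =
      (a.sum fun g c => j c * y g) + b.sum fun g c => j c * y g := fun a b =>
    Finsupp.sum_add_index' hz fun g c d => by rw [map_add, add_mul]
  induction hx using Algebra.adjoin_induction with
  | mem x hx =>
    rcases hx with ⟨a, rfl⟩ | ⟨g, rfl⟩
    · exact ⟨Finsupp.single 1 a, by rw [Finsupp.sum_single_index (hz _), map_one, mul_one]⟩
    · exact ⟨Finsupp.single g 1, by rw [Finsupp.sum_single_index (hz _), map_one, one_mul]⟩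
  | algebraMap c =>
    exact ⟨Finsupp.single 1 (algebraMap ℂ A c), by
      rw [Finsupp.sum_single_index (hz _), map_one, mul_one, AlgHom.commutes]⟩
  | add x₁ x₂ _ _ h₁ h₂ =>
    obtain ⟨a, rfl⟩ := h₁
    obtain ⟨b, rfl⟩ := h₂
    exact ⟨a + b, (hadd a b).symm⟩
  | mul x₁ x₂ _ _ h₁ h₂ =>
    obtain ⟨a, rfl⟩ := h₁
    obtain ⟨b, rfl⟩ := h₂
    -- The hypotheses on `a` and `b` as elements of the algebra would block the inductions.
    clear * - h hz hadd
    induction a using Finsupp.induction_linear with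
    | zero => exact ⟨0, by simp⟩
    | add a a' iha iha' =>
      obtain ⟨c, hc⟩ := iha
      obtain ⟨c', hc'⟩ := iha'
      exact ⟨c + c', by rw [hadd, hadd, add_mul, hc, hc']⟩
    | single g a =>
      induction b using Finsupp.induction_linear with
      | zero => exact ⟨0, by simp⟩
      | add b b' ihb ihb' =>
        obtain ⟨c, hc⟩ := ihb
        obtain ⟨c', hc'⟩ := ihb'
        exact ⟨c + c', by rw [hadd, hadd, mul_add, hc, hc']⟩
      | single k b =>
        obtain ⟨b', hb'⟩ := h g b
        refine ⟨Finsupp.single (g * k) (a * b'), ?_⟩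
        rw [Finsupp.sum_single_index (hz _), Finsupp.sum_single_index (hz _),
          Finsupp.sum_single_index (hz _), map_mul, map_mul, mul_assoc, ← mul_assoc (y g), hb']
        simp only [mul_assoc]

variable {X : Type*} [NormedAddCommGroup X] [NormedSpace ℂ X]

/-- `g ↦ T_g` as a monoid homomorphism into `L(X)`. -/
def opHom (T : G →* (X ≃ₗᵢ[ℂ] X)) : G →* (X →L[ℂ] X) where
  toFun := op T
  map_one' := by ext x; simp
  map_mul' g h := by ext x; simp

theorem op_mul_eq_hat_mul_op (T : G →* (X ≃ₗᵢ[ℂ] X)) (g : G) (a : X →L[ℂ] X) :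
    op T g * a = hat T g a * op T g := by
  ext x
  simp [hat_apply]

theorem denseRange_finSum (A : Subalgebra ℂ (X →L[ℂ] X)) (T : G →* (X ≃ₗᵢ[ℂ] X))
    (hA : ∀ g, ∀ a ∈ A, hat T g a ∈ A) :
    DenseRange fun a : G →₀ A => (⟨finSum A T a, finSum_mem A T a⟩ : B A T) := by
  have hsub : ∀ x ∈ Algebra.adjoin ℂ ((A : Set (X →L[ℂ] X)) ∪ Set.range (op T)),
      ∃ a, x = finSum A T a := by
    intro x hx
    refine exists_finsupp_sum_of_mem_adjoin A.val (opHom T)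
      (fun g a => ⟨⟨hat T g a, hA g a a.2⟩, op_mul_eq_hat_mul_op T g a⟩) (x := x) ?_
    have e : Set.range A.val = (A : Set (X →L[ℂ] X)) := Subtype.range_coe
    rw [e]
    exact hx
  intro b
  rw [mem_closure_iff_seq_limit]
  obtain ⟨u, hu, hlim⟩ := mem_closure_iff_seq_limit.1 (show (b : X →L[ℂ] X) ∈ closure
    (Algebra.adjoin ℂ ((A : Set (X →L[ℂ] X)) ∪ Set.range (op T)) : Set (X →L[ℂ] X)) from b.2)
  choose a ha using fun n => hsub (u n) (hu n)
  refine ⟨fun n => ⟨finSum A T (a n), finSum_mem A T _⟩, fun n => ⟨a n, rfl⟩, ?_⟩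
  rw [tendsto_subtype_rng]
  simpa only [← ha] using hlim

theorem coe_sum_lp {Y J : Type*} [NormedAddCommGroup Y] (p : ℝ≥0∞) {ι : Type*} (s : Finset ι)
    (f : ι → lp (fun _ : J => Y) p) (h : J) :
    (∑ i ∈ s, f i) h = ∑ i ∈ s, f i h := by
  rw [lp.coeFn_sum, Finset.sum_apply]

variable (p : ℝ≥0∞) [Fact (1 ≤ p)]

/-- The finite sum `∑ ā_g V_g` in the regular representation. -/
def regSum (T : G →* (X ≃ₗᵢ[ℂ] X)) (s : Finset G) (a : G → X →L[ℂ] X) :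
    lp (fun _ : G => X) p →L[ℂ] lp (fun _ : G => X) p :=
  ∑ g ∈ s, bar p T (a g) * op (V X p) g

theorem regSum_apply (T : G →* (X ≃ₗᵢ[ℂ] X)) (s : Finset G) (a : G → X →L[ℂ] X)
    (ξ : lp (fun _ : G => X) p) (h : G) :
    regSum p T s a ξ h = ∑ g ∈ s, hat T h (a g) (ξ (h * g)) := by
  rw [regSum, sum_apply, coe_sum_lp]
  rfl

theorem op_V_mul_bar (T : G →* (X ≃ₗᵢ[ℂ] X)) (g : G) (a : X →L[ℂ] X) :
    op (V X p) g * bar p T a = bar p T (hat T g a) * op (V X p) g := by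
  ext ξ h
  simp [hat_apply]

/-- Equality of the norms of finite sums gives the isometric isomorphism of `B(A, T_g)` onto the
regular representation. -/
theorem exists_regular_algEquiv [CompleteSpace X] (A : Subalgebra ℂ (X →L[ℂ] X))
    (T : G →* (X ≃ₗᵢ[ℂ] X)) (hA : ∀ g, ∀ a ∈ A, hat T g a ∈ A)
    (hnorm : ∀ a : G →₀ A, ‖finSum A T a‖ = ‖regSum p T a.support fun g => a g‖) :
    ∃ Φ : B A T ≃ₐ[ℂ] B (barAlg p A T) (V X p), Isometry Φ ∧
      (∀ a (ha : a ∈ A), Φ ⟨a, coeff_mem _ _ ha⟩ =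
        ⟨bar p T a, coeff_mem _ _ (bar_mem p _ _ ha)⟩) ∧
      ∀ g, Φ ⟨op T g, op_mem _ _ g⟩ = ⟨op (V X p) g, op_mem _ _ g⟩ := by
  let j : A →ₐ[ℂ] (X →L[ℂ] X) × (lp (fun _ : G => X) p →L[ℂ] lp (fun _ : G => X) p) :=
    A.val.prod ((bar p T).comp A.val)
  let y := (opHom T).prod (opHom (V X p))
  have hU : Prod.fst '' (Set.range j ∪ Set.range y) = (A : Set (X →L[ℂ] X)) ∪ Set.range (op T) := by
    rw [Set.image_union, ← Set.range_comp, ← Set.range_comp]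
    congr 1
    exact Subtype.range_coe
  have hW : Prod.snd '' (Set.range j ∪ Set.range y) =
      (barAlg p A T : Set _) ∪ Set.range (op (V X p)) := by
    rw [Set.image_union, ← Set.range_comp, ← Set.range_comp]
    congr 1
    ext c
    constructor
    · rintro ⟨a, rfl⟩
      exact bar_mem p A T a.2
    · rintro ⟨a, ha, rfl⟩
      exact ⟨⟨a, ha⟩, rfl⟩
  obtain ⟨Φ, hΦ, hgen⟩ := exists_isometric_algEquiv hU hW (by
    intro x hx
    obtain ⟨a, rfl⟩ := exists_finsupp_sum_of_mem_adjoin j y (fun g a =>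
      ⟨⟨hat T g a, hA g a a.2⟩, Prod.ext (op_mul_eq_hat_mul_op T g a) (op_V_mul_bar p T g a)⟩) hx
    rw [Finsupp.sum, Prod.fst_sum, Prod.snd_sum]
    exact hnorm a)
  exact ⟨Φ, hΦ, fun a ha => Subtype.ext (hgen _ (Or.inl ⟨⟨a, ha⟩, rfl⟩) _ rfl),
    fun g => Subtype.ext (hgen _ (Or.inr ⟨g, rfl⟩) _ rfl)⟩

theorem map_finSum_eq_regSum {A : Subalgebra ℂ (X →L[ℂ] X)} {T : G →* (X ≃ₗᵢ[ℂ] X)}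
    (Φ : B A T ≃ₐ[ℂ] B (barAlg p A T) (V X p))
    (h₁ : ∀ a (ha : a ∈ A), Φ ⟨a, coeff_mem _ _ ha⟩ =
        ⟨bar p T a, coeff_mem _ _ (bar_mem p _ _ ha)⟩)
    (h₂ : ∀ g, Φ ⟨op T g, op_mem _ _ g⟩ = ⟨op (V X p) g, op_mem _ _ g⟩) (a : G →₀ A) :
    (Φ ⟨finSum A T a, finSum_mem A T a⟩ : lp (fun _ : G => X) p →L[ℂ] lp (fun _ : G => X) p) =
      regSum p T a.support fun g => a g := by
  have : (⟨finSum A T a, finSum_mem A T a⟩ : B A T) =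
      ∑ g ∈ a.support, ⟨(a g : X →L[ℂ] X), coeff_mem _ _ (a g).2⟩ * ⟨op T g, op_mem _ _ g⟩ := by
    apply Subtype.ext
    rw [AddSubmonoidClass.coe_finsetSum]
    rfl
  rw [this, map_sum, AddSubmonoidClass.coe_finsetSum, regSum]
  refine Finset.sum_congr rfl fun g _ => ?_
  rw [map_mul, h₁ _ (a g).2, h₂]
  rfl

/-- The matrix entries of the regular representation of a finite sum are translates of its
coefficients. -/
theorem regSum_single_apply [DecidableEq G] (T : G →* (X ≃ₗᵢ[ℂ] X))
    {A : Subalgebra ℂ (X →L[ℂ] X)} (a : G →₀ A) (h k : G) (x : X) :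
    regSum p T a.support (fun g => a g) (lp.single p (h * k) x) h =
      hat T h (a k : X →L[ℂ] X) x := by
  rw [regSum_apply, Finset.sum_eq_single k]
  · rw [lp.single_apply_self]
  · intro g _ hg
    rw [lp.single_apply_ne _ _ _ (by simpa using hg), map_zero]
  · intro hk
    rw [Finsupp.notMem_support_iff.1 hk]
    simp [hat_apply]

theorem norm_coeff_le_norm_regSum (T : G →* (X ≃ₗᵢ[ℂ] X)) {A : Subalgebra ℂ (X →L[ℂ] X)}
    (a : G →₀ A) (k : G) : ‖a k‖ ≤ ‖regSum p T a.support fun g => a g‖ := by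
  classical
  refine ContinuousLinearMap.opNorm_le_bound _ (norm_nonneg _) fun x => ?_
  have hp0 : 0 < p := zero_lt_one.trans_le Fact.out
  have h := regSum_single_apply p T a 1 k x
  have e : hat T 1 (a k : X →L[ℂ] X) x = (a k : X →L[ℂ] X) x := by simp [hat_apply]
  change ‖(a k : X →L[ℂ] X) x‖ ≤ _
  rw [← e, ← h]
  refine (lp.norm_apply_le_norm hp0.ne' _ _).trans ?_
  refine (ContinuousLinearMap.le_opNorm _ _).trans_eq ?_
  rw [lp.norm_single hp0]

/-- The coefficients `χ(g) a_g` arise from conjugation by multiplication with `χ`. -/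
theorem norm_regSum_character_le (T : G →* (X ≃ₗᵢ[ℂ] X)) (hp : p ≠ ∞) (χ : G →* Circle)
    (s : Finset G) (a : G → X →L[ℂ] X) :
    ‖regSum p T s fun g => (χ g : ℂ) • a g‖ ≤ ‖regSum p T s a‖ := by
  have hp0 : 0 < p := zero_lt_one.trans_le Fact.out
  have hpt : 0 < p.toReal := ENNReal.toReal_pos hp0.ne' hp
  -- Multiplication by `χ` is an isometry of `ℓ^p(G, X)`
  have hmem : ∀ ξ : lp (fun _ : G => X) p, Memℓp (fun g => (χ g : ℂ) • ξ g) p := fun ξ => by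
    refine (memℓp_gen_iff hpt).2 ?_
    simpa [norm_smul, Circle.norm_coe] using (memℓp_gen_iff hpt).1 (lp.memℓp ξ)
  have hiso : ∀ ξ η : lp (fun _ : G => X) p, (∀ g, η g = (χ g : ℂ) • ξ g) → ‖η‖ = ‖ξ‖ := by
    intro ξ η h
    rw [lp.norm_eq_tsum_rpow hpt, lp.norm_eq_tsum_rpow hpt]
    simp [h, norm_smul, Circle.norm_coe]
  refine ContinuousLinearMap.opNorm_le_bound _ (norm_nonneg _) fun ξ => ?_
  let η : lp (fun _ : G => X) p := ⟨fun g => (χ g : ℂ) • ξ g, hmem ξ⟩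
  rw [← hiso ξ η fun g => rfl]
  refine le_trans (hiso _ (regSum p T s a η) fun h => ?_).ge
    (ContinuousLinearMap.le_opNorm _ _)
  rw [regSum_apply, regSum_apply, Finset.smul_sum]
  refine Finset.sum_congr rfl fun g _ => ?_
  change hat T h (a g) ((χ (h * g) : ℂ) • ξ (h * g)) = _
  simp [hat_apply, mul_smul]

theorem norm_regSum_character (T : G →* (X ≃ₗᵢ[ℂ] X)) (hp : p ≠ ∞) (χ : G →* Circle)
    (s : Finset G) (a : G → X →L[ℂ] X) :
    ‖regSum p T s fun g => (χ g : ℂ) • a g‖ = ‖regSum p T s a‖ := by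
  refine le_antisymm (norm_regSum_character_le p T hp χ s a) ?_
  have h := norm_regSum_character_le p T hp χ⁻¹ s fun g => (χ g : ℂ) • a g
  refine le_of_eq_of_le ?_ h
  congr 2
  ext g x
  simp

/-- An operator on `ℓ^p(J, X)` vanishes if it kills all vectors supported at one point. -/
theorem eq_zero_of_single {J : Type*} [DecidableEq J] {Y : Type*} [NormedAddCommGroup Y]
    [NormedSpace ℂ Y] (hp : p ≠ ∞) (S : lp (fun _ : J => X) p →L[ℂ] Y)
    (h : ∀ k x, S (lp.single p k x) = 0) : S = 0 := by
  ext ξ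
  have := (lp.hasSum_single hp ξ).mapL S
  simp only [h] at this
  exact this.unique hasSum_zero

/-- The consequences of the equality of norms of finite sums in `B(A, T_g)` and in the regular
representation, for an invariant closed algebra `A` of coefficients. -/
theorem regular_representation [CompleteSpace X] (A : Subalgebra ℂ (X →L[ℂ] X))
    (T : G →* (X ≃ₗᵢ[ℂ] X)) (hp : p ≠ ∞) (hA : ∀ g, ∀ a ∈ A, hat T g a ∈ A)
    (hcl : IsClosed (A : Set (X →L[ℂ] X)))
    (hnorm : ∀ a : G →₀ A, ‖finSum A T a‖ = ‖regSum p T a.support fun g => a g‖) :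
    (∃ Φ : B A T ≃ₐ[ℂ] B (barAlg p A T) (V X p), Isometry Φ ∧
      (∀ a (ha : a ∈ A), Φ ⟨a, coeff_mem _ _ ha⟩ =
        ⟨bar p T a, coeff_mem _ _ (bar_mem p _ _ ha)⟩) ∧
      ∀ g, Φ ⟨op T g, op_mem _ _ g⟩ = ⟨op (V X p) g, op_mem _ _ g⟩) ∧
    PropStar A T ∧ PropStarStar A T ∧ CharInvariant A T := by
  have hstar : PropStar A T := fun a => (norm_coeff_le_norm_regSum p T a 1).trans_eq (hnorm a).symm
  obtain ⟨Φ, hΦ, h₁, h₂⟩ := exists_regular_algEquiv p A T hA hnorm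
  refine ⟨⟨Φ, hΦ, h₁, h₂⟩, hstar, ⟨hstar, ?_⟩, ?_⟩
  · classical
    have hdense := denseRange_finSum A T hA
    have hfin := map_finSum_eq_regSum p Φ h₁ h₂
    let ΦL : B A T →L[ℂ] (lp (fun _ : G => X) p →L[ℂ] lp (fun _ : G => X) p) :=
      ⟨(B (barAlg p A T) (V X p)).val.toLinearMap ∘ₗ Φ.toLinearMap,
        continuous_subtype_val.comp hΦ.continuous⟩
    -- The entry of `Φ(b)` in row `h` and column `k`
    let entry : G → G → B A T →L[ℂ] (X →L[ℂ] X) := fun h k =>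
      (ContinuousLinearMap.compL ℂ X (lp (fun _ : G => X) p) X
        (lp.evalCLM ℂ (fun _ : G => X) p h)) ∘L
        ((ContinuousLinearMap.compL ℂ X (lp (fun _ : G => X) p) (lp (fun _ : G => X) p)).flip
          (lp.singleContinuousLinearMap ℂ (fun _ : G => X) p k)) ∘L ΦL
    have entry_apply : ∀ h k b x, entry h k b x =
        (Φ b : lp (fun _ : G => X) p →L[ℂ] lp (fun _ : G => X) p) (lp.single p k x) h :=
      fun h k b x => rfl
    have entry_finSum : ∀ h k (a : G →₀ A),
        entry h (h * k) ⟨finSum A T a, finSum_mem A T a⟩ = hat T h (a k) := by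
      intro h k a
      ext x
      rw [entry_apply, hfin, regSum_single_apply]
    have hat_one : ∀ a, hat T 1 a = a := fun a => by ext x; simp [hat_apply]
    have entry_one : ∀ k (a : G →₀ A), entry 1 k ⟨finSum A T a, finSum_mem A T a⟩ = a k := by
      intro k a
      have := entry_finSum 1 k a
      rwa [one_mul, hat_one] at this
    have hmem : ∀ k b, entry 1 k b ∈ A := fun k b =>
      hdense.induction_on b (hcl.preimage (entry 1 k).continuous) fun a => by
        rw [entry_one]; exact (a k).2
    have hcont : ∀ h, Continuous (hat T h) := fun h => by unfold hat; fun_prop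
    -- All entries are determined by those in the row of the identity.
    have hcov : ∀ h k b, entry h (h * k) b = hat T h (entry 1 k b) := fun h k b =>
      hdense.induction_on b
        (isClosed_eq (entry h (h * k)).continuous ((hcont h).comp (entry 1 k).continuous))
        fun a => by rw [entry_finSum, entry_one]
    refine ⟨fun k => (entry 1 k).codRestrict (Subalgebra.toSubmodule A) (hmem k),
      fun k a => Subtype.ext (entry_one k a), fun b => ⟨fun hb k => by rw [hb, map_zero], ?_⟩⟩
    intro hb
    have hb' : ∀ k, entry 1 k b = 0 := fun k => congrArg Subtype.val (hb k)
    have hzero : (Φ b : lp (fun _ : G => X) p →L[ℂ] lp (fun _ : G => X) p) = 0 := by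
      refine eq_zero_of_single p hp _ fun k x => ?_
      ext h
      have := hcov h (h⁻¹ * k) b
      rw [mul_inv_cancel_left, hb'] at this
      rw [← entry_apply, this]
      simp [hat_apply]
    exact (map_eq_zero_iff Φ Φ.injective).1 (Subtype.ext hzero)
  · intro χ a
    have hsupp : ∀ g, (χ g : ℂ) • a g ≠ 0 ↔ g ∈ a.support := fun g => by
      rw [Finsupp.mem_support_iff, Ne, smul_eq_zero, not_or]
      exact and_iff_right (Circle.coe_ne_zero _)
    let a' : G →₀ A := ⟨a.support, fun g => (χ g : ℂ) • a g, fun g => (hsupp g).symm⟩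
    have e : ∑ g ∈ a.support, (χ g : ℂ) • ((a g : X →L[ℂ] X) * op T g) = finSum A T a' :=
      Finset.sum_congr rfl fun g _ => (smul_mul_assoc _ _ _).symm
    rw [e, hnorm a, hnorm a']
    exact (norm_regSum_character p T hp χ a.support fun g => a g).symm

end FiniteSums

/-! ### Amenability: almost invariant vectors and the lower bound for the norm -/

section Amenable

variable {G : Type*} [Group G]

/-- An invariant mean kills sums of differences of translates, so that these cannot be bounded
below by a positive constant. -/
theorem IsAmenable.not_forall_le_sum_sub (hG : IsAmenable G) (s : Finset G) (u : G → G → ℝ)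
    {C : ℝ} (hu : ∀ g x, |u g x| ≤ C) {c : ℝ} (hc : 0 < c)
    (h : ∀ x, c ≤ ∑ g ∈ s, (u g (g * x) - u g x)) : False := by
  obtain ⟨m, hpos, hone, hinv⟩ := hG
  have hmem : ∀ v : G → ℝ, (∀ x, |v x| ≤ C) → Memℓp v ∞ := fun v hv => by
    refine memℓp_infty ⟨C, ?_⟩
    rintro _ ⟨x, rfl⟩
    exact hv x
  let U : G → lp (fun _ : G => ℝ) ∞ := fun g => ⟨u g, hmem _ (hu g)⟩
  let U' : G → lp (fun _ : G => ℝ) ∞ := fun g => ⟨fun x => u g (g * x), hmem _ fun x => hu g _⟩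
  have hm : m (∑ g ∈ s, (U' g - U g)) = 0 := by
    rw [map_sum]
    refine Finset.sum_eq_zero fun g _ => ?_
    rw [map_sub, hinv g (U g) (U' g) fun x => rfl, sub_self]
  have hle : 0 ≤ m (∑ g ∈ s, (U' g - U g) - c • 1) := by
    refine hpos _ fun x => ?_
    have e : (∑ g ∈ s, (U' g - U g) - c • (1 : lp (fun _ : G => ℝ) ∞)) x =
        ∑ g ∈ s, (u g (g * x) - u g x) - c := by
      rw [lp.coeFn_sub, Pi.sub_apply, lp.coeFn_sum, Finset.sum_apply, lp.coeFn_smul,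
        lp.infty_coeFn_one]
      simp only [lp.coeFn_sub, Pi.sub_apply, Pi.smul_apply, Pi.one_apply, smul_eq_mul, mul_one]
      rfl
    rw [e]
    exact sub_nonneg.2 (h x)
  rw [map_sub, hm, map_smul, hone, smul_eq_mul, mul_one, zero_sub] at hle
  linarith

/-- Almost right-invariant unit vectors in `ℓ^1(G)`. If the differences `V_g f - f`, for `f` a
convex combination of point masses, stayed away from zero, a separating functional would produce
bounded functions contradicting the existence of an invariant mean. -/
theorem IsAmenable.exists_almost_invariant_one (hG : IsAmenable G) (s : Finset G) {ε : ℝ}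
    (hε : 0 < ε) : ∃ f : lp (fun _ : G => ℂ) 1, ‖f‖ = 1 ∧ ∀ g ∈ s, ‖V ℂ 1 g f - f‖ ≤ ε := by
  classical
  let e : G → lp (fun _ : G => ℂ) 1 := fun x => lp.single 1 x (1 : ℂ)
  have hVe : ∀ g x, V ℂ 1 g (e x) = e (x * g⁻¹) := by
    intro g x
    ext y
    rw [V_apply, lp.single_apply, lp.single_apply]
    by_cases hy : y * g = x
    · subst hy; simp
    · have : y ≠ x * g⁻¹ := fun h => hy (by rw [h]; simp)
      simp [hy, this]
  let D : lp (fun _ : G => ℂ) 1 →ₗ[ℝ] (s → lp (fun _ : G => ℂ) 1) :=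
    LinearMap.pi fun g =>
      ((V ℂ 1 (g : G)).toLinearEquiv.toLinearMap.restrictScalars ℝ) - LinearMap.id
  have hD : ∀ f (g : s), D f g = V ℂ 1 (g : G) f - f := fun f g => rfl
  have hmem : (0 : s → lp (fun _ : G => ℂ) 1) ∈ closure (D '' convexHull ℝ (Set.range e)) := by
    by_contra h0
    obtain ⟨φ, c, hc, hφ⟩ := geometric_hahn_banach_point_closed
      (((convex_convexHull ℝ _).linear_image D).closure) isClosed_closure h0
    rw [map_zero] at hc
    -- The mean is left invariant while `V` translates on the right, whence the inverses.
    let u : G → G → ℝ := fun g y => if hg : g ∈ s then φ (Pi.single ⟨g, hg⟩ (e y⁻¹)) else 0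
    refine hG.not_forall_le_sum_sub s u (C := ‖φ‖) ?_ hc fun x => ?_
    · intro g y
      by_cases hg : g ∈ s
      · simp only [u, hg, dif_pos]
        refine (φ.le_opNorm _).trans ?_
        rw [Pi.norm_single, lp.norm_single one_pos, norm_one, mul_one]
      · simp [u, hg]
    · have hx := hφ (D (e x⁻¹)) (subset_closure ⟨_, subset_convexHull ℝ _ ⟨_, rfl⟩, rfl⟩)
      refine hx.le.trans_eq ?_
      rw [← Finset.univ_sum_single (D (e x⁻¹)), map_sum, ← Finset.sum_coe_sort s]
      refine Finset.sum_congr rfl fun g _ => ?_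
      rw [hD, hVe]
      simp [u, Pi.single_sub]
  obtain ⟨_, ⟨f, hf, rfl⟩, hfε⟩ := Metric.mem_closure_iff.1 hmem ε hε
  -- `∑ f(x) = 1` and `‖f‖ ≤ 1` pass to convex combinations, and together force `‖f‖ = 1`.
  have hconv : Convex ℝ {f : lp (fun _ : G => ℂ) 1 | HasSum (fun x => f x) 1} := by
    intro f hf g hg a b _ _ hab
    have := (hf.const_smul a).add (hg.const_smul b)
    rw [← add_smul, hab, one_smul] at this
    exact this
  have hsum : HasSum (fun x => f x) 1 := by
    refine convexHull_min ?_ hconv hf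
    rintro _ ⟨x, rfl⟩
    have := hasSum_single (f := fun y => e x y) x fun y hy => lp.single_apply_ne _ _ _ hy
    rwa [lp.single_apply_self] at this
  have hle : ‖f‖ ≤ 1 := by
    have := convexHull_min ?_ (convex_closedBall (0 : lp (fun _ : G => ℂ) 1) 1) hf
    · simpa using this
    · rintro _ ⟨x, rfl⟩
      rw [mem_closedBall_zero_iff, lp.norm_single one_pos, norm_one]
  refine ⟨f, le_antisymm hle ?_, fun g hg => ?_⟩
  · have h1 := (lp.memℓp f).summable (by simp)
    have h2 := lp.norm_eq_tsum_rpow (by simp) f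
    simp only [ENNReal.toReal_one, Real.rpow_one, div_one] at h1 h2
    rw [h2, ← norm_one (α := ℂ), ← hsum.tsum_eq]
    exact norm_tsum_le_tsum_norm h1
  · rw [dist_zero_left] at hfε
    exact ((norm_le_pi_norm (D f) ⟨g, hg⟩).trans hfε.le)

theorem abs_rpow_inv_sub_rpow_inv_rpow_le {a b q : ℝ} (ha : 0 ≤ a) (hb : 0 ≤ b)
    (hq : 1 ≤ q) : |a ^ q⁻¹ - b ^ q⁻¹| ^ q ≤ |a - b| := by
  wlog hab : b ≤ a generalizing a b
  · rw [abs_sub_comm, abs_sub_comm a]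
    exact this hb ha (le_of_not_ge hab)
  have hq0 : q ≠ 0 := by positivity
  have h1 : b ^ q⁻¹ ≤ a ^ q⁻¹ := Real.rpow_le_rpow hb hab (by positivity)
  rw [abs_of_nonneg (sub_nonneg.2 h1), abs_of_nonneg (sub_nonneg.2 hab)]
  have h2 := Real.add_rpow_le_rpow_add (sub_nonneg.2 h1) (Real.rpow_nonneg hb q⁻¹) hq
  rw [sub_add_cancel, Real.rpow_inv_rpow ha hq0, Real.rpow_inv_rpow hb hq0] at h2
  linarith

variable (p : ℝ≥0∞) [Fact (1 ≤ p)]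

/-- Almost right-invariant unit vectors in `ℓ^p(G)`: the `p`-th roots of the absolute values of
those in `ℓ^1(G)`. -/
theorem IsAmenable.exists_almost_invariant (hG : IsAmenable G) (hp : p ≠ ∞) (s : Finset G) {ε : ℝ}
    (hε : 0 < ε) : ∃ φ : lp (fun _ : G => ℂ) p, ‖φ‖ = 1 ∧ ∀ g ∈ s, ‖V ℂ p g φ - φ‖ ≤ ε := by
  have hp1 : (1 : ℝ) ≤ p.toReal := by
    simpa using ENNReal.toReal_mono hp (Fact.out : 1 ≤ p)
  have hp0 : 0 < p.toReal := by positivity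
  obtain ⟨f, hf, hfs⟩ := hG.exists_almost_invariant_one s (Real.rpow_pos_of_pos hε p.toReal)
  have hnorm1 : ∀ f : lp (fun _ : G => ℂ) 1, Summable (fun x => ‖f x‖) ∧ ‖f‖ = ∑' x, ‖f x‖ := by
    intro f
    have h1 := (lp.memℓp f).summable (by simp)
    have h2 := lp.norm_eq_tsum_rpow (by simp) f
    simpa only [ENNReal.toReal_one, Real.rpow_one, div_one] using And.intro h1 h2
  have hroot : ∀ x, ‖((‖f x‖ ^ p.toReal⁻¹ : ℝ) : ℂ)‖ ^ p.toReal = ‖f x‖ := fun x => by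
    rw [Complex.norm_real, Real.norm_of_nonneg (by positivity),
      Real.rpow_inv_rpow (norm_nonneg _) hp0.ne']
  let φ : lp (fun _ : G => ℂ) p := ⟨fun x => ((‖f x‖ ^ p.toReal⁻¹ : ℝ) : ℂ), by
    refine (memℓp_gen_iff hp0).2 ?_
    simp only [hroot]
    exact (hnorm1 f).1⟩
  refine ⟨φ, ?_, fun g hg => ?_⟩
  · rw [lp.norm_eq_tsum_rpow hp0]
    have : ∑' x, ‖φ x‖ ^ p.toReal = 1 := by
      rw [← hf, (hnorm1 f).2]
      exact tsum_congr hroot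
    rw [this, Real.one_rpow]
  · rw [← Real.rpow_le_rpow_iff (norm_nonneg _) hε.le hp0]
    refine le_trans ?_ (hfs g hg)
    rw [(hnorm1 _).2, lp.norm_rpow_eq_tsum hp0]
    refine Summable.tsum_le_tsum (fun x => ?_) ((lp.memℓp _).summable hp0) (hnorm1 _).1
    have e : (V ℂ p g φ - φ) x =
        ((‖f (x * g)‖ ^ p.toReal⁻¹ - ‖f x‖ ^ p.toReal⁻¹ : ℝ) : ℂ) := by
      rw [Complex.ofReal_sub]; rfl
    rw [e, Complex.norm_real, Real.norm_eq_abs]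
    exact (abs_rpow_inv_sub_rpow_inv_rpow_le (norm_nonneg _) (norm_nonneg _) hp1).trans
      (abs_norm_sub_norm_le _ _)

variable {X : Type*} [NormedAddCommGroup X] [NormedSpace ℂ X]

/-- The vector `h ↦ φ(h) T_h x` of `ℓ^p(G, X)`. -/
def orbitVec (hp : 0 < p.toReal) (T : G →* (X ≃ₗᵢ[ℂ] X)) (φ : lp (fun _ : G => ℂ) p) (x : X) :
    lp (fun _ : G => X) p :=
  ⟨fun h => φ h • T h x, by
    refine (memℓp_gen_iff hp).2 ?_
    simp only [norm_smul, LinearIsometryEquiv.norm_map,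
      Real.mul_rpow (norm_nonneg _) (norm_nonneg x)]
    exact ((memℓp_gen_iff hp).1 (lp.memℓp φ)).mul_right _⟩

theorem norm_orbitVec (hp : 0 < p.toReal) (T : G →* (X ≃ₗᵢ[ℂ] X)) (φ : lp (fun _ : G => ℂ) p)
    (x : X) : ‖orbitVec p hp T φ x‖ = ‖φ‖ * ‖x‖ := by
  have h : ‖orbitVec p hp T φ x‖ ^ p.toReal = (‖φ‖ * ‖x‖) ^ p.toReal := by
    rw [Real.mul_rpow (norm_nonneg _) (norm_nonneg x), lp.norm_rpow_eq_tsum hp,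
      lp.norm_rpow_eq_tsum hp, ← tsum_mul_right]
    refine tsum_congr fun h => ?_
    change ‖φ h • T h x‖ ^ _ = _
    rw [norm_smul, LinearIsometryEquiv.norm_map, Real.mul_rpow (norm_nonneg _) (norm_nonneg x)]
  exact (Real.rpow_left_inj (norm_nonneg _) (by positivity) hp.ne').1 h

/-- For amenable `G`, the regular representation does not decrease norms: it acts on
`h ↦ φ(h) T_h x`, for almost invariant `φ`, approximately as the original operator acts on `x`. -/
theorem norm_sum_le_norm_regSum (hG : IsAmenable G) (hp : p ≠ ∞) (T : G →* (X ≃ₗᵢ[ℂ] X))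
    (s : Finset G) (a : G → X →L[ℂ] X) :
    ‖∑ g ∈ s, a g * op T g‖ ≤ ‖regSum p T s a‖ := by
  have hp1 : (1 : ℝ) ≤ p.toReal := by
    simpa using ENNReal.toReal_mono hp (Fact.out : 1 ≤ p)
  have hp0 : 0 < p.toReal := by positivity
  refine ContinuousLinearMap.opNorm_le_bound _ (norm_nonneg _) fun x => ?_
  set K : ℝ := ∑ g ∈ s, ‖a g (T g x)‖ with hK
  have hK0 : 0 ≤ K := Finset.sum_nonneg fun g _ => norm_nonneg _
  refine le_of_forall_pos_le_add fun δ hδ => ?_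
  obtain ⟨φ, hφ, hφs⟩ := hG.exists_almost_invariant p hp s (ε := δ / (K + 1)) (by positivity)
  -- The error term involves only the differences `V_g φ - φ`.
  have e : orbitVec p hp0 T φ ((∑ g ∈ s, a g * op T g) x) =
      regSum p T s a (orbitVec p hp0 T φ x) -
        ∑ g ∈ s, orbitVec p hp0 T (V ℂ p g φ - φ) (a g (T g x)) := by
    ext h
    rw [lp.coeFn_sub, Pi.sub_apply, regSum_apply, coe_sum_lp, ← Finset.sum_sub_distrib]
    change φ h • T h ((∑ g ∈ s, a g * op T g) x) =
      ∑ g ∈ s, (hat T h (a g) (φ (h * g) • T (h * g) x) -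
        (φ (h * g) - φ h) • T h (a g (T g x)))
    rw [sum_apply, map_sum, Finset.smul_sum]
    refine Finset.sum_congr rfl fun g _ => ?_
    simp [hat_apply, sub_smul]
  have h1 := norm_orbitVec p hp0 T φ ((∑ g ∈ s, a g * op T g) x)
  rw [hφ, one_mul] at h1
  rw [← h1, e]
  refine (norm_sub_le _ _).trans (add_le_add ?_ ?_)
  · refine (ContinuousLinearMap.le_opNorm _ _).trans_eq ?_
    rw [norm_orbitVec, hφ, one_mul]
  · refine (norm_sum_le _ _).trans ?_
    have : ∀ g ∈ s, ‖orbitVec p hp0 T (V ℂ p g φ - φ) (a g (T g x))‖ ≤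
        δ / (K + 1) * ‖a g (T g x)‖ := fun g hg => by
      rw [norm_orbitVec]
      exact mul_le_mul_of_nonneg_right (hφs g hg) (norm_nonneg _)
    refine (Finset.sum_le_sum this).trans ?_
    rw [← Finset.mul_sum, ← hK, div_mul_eq_mul_div, div_le_iff₀ (by positivity)]
    nlinarith

end Amenable

/-! ### Multiplication operators on `L^p(Ω, E)` -/

section Multiplication

variable {Ω : Type*} [MeasurableSpace Ω] {E : Type*} [NormedAddCommGroup E] [NormedSpace ℂ E]
  {μ : Measure Ω}

/-- A pointwise almost everywhere inequality follows from integral inequalities on sufficiently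
many sets. -/
theorem ae_le_of_exists_setLIntegral_le {f g : Ω → ℝ≥0∞} (hf : Measurable f) (hg : Measurable g)
    (hfin : ∫⁻ x, g x ∂μ ≠ ∞)
    (h : ∀ Δ, MeasurableSet Δ → 0 < μ Δ → ∃ Δ' ⊆ Δ, MeasurableSet Δ' ∧ 0 < μ Δ' ∧
      ∫⁻ x in Δ', f x ∂μ ≤ ∫⁻ x in Δ', g x ∂μ) : ∀ᵐ x ∂μ, f x ≤ g x := by
  by_contra hne
  have hpos : 0 < μ {x | g x < f x} := by
    rw [pos_iff_ne_zero]
    simpa [ae_iff] using hne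
  obtain ⟨Δ', hsub, hm, hμ, hle⟩ := h _ (measurableSet_lt hg hf) hpos
  refine hle.not_gt (setLIntegral_strict_mono hm hμ.ne' hf ?_ (.of_forall fun x hx => hsub hx))
  exact ((setLIntegral_le_lintegral _ _).trans_lt hfin.lt_top).ne

theorem coeFn_sum_Lp {p : ℝ≥0∞} {F : Type*} [NormedAddCommGroup F] {ι : Type*}
    (s : Finset ι) (f : ι → Lp F p μ) : ∀ᵐ x ∂μ, (∑ i ∈ s, f i : Lp F p μ) x = ∑ i ∈ s, f i x := by
  classical
  induction s using Finset.induction_on with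
  | empty =>
    simp only [Finset.sum_empty]
    exact Lp.coeFn_zero F p μ
  | insert i s hi ih =>
    rw [Finset.sum_insert hi]
    filter_upwards [ih, Lp.coeFn_add (f i) (∑ j ∈ s, f j)] with x h1 h2
    rw [h2, Pi.add_apply, h1, Finset.sum_insert hi]

theorem ae_norm_le_norm_Lp_top {F : Type*} [NormedAddCommGroup F] (a : Lp F ∞ μ) :
    ∀ᵐ x ∂μ, ‖a x‖ ≤ ‖a‖ := by
  filter_upwards [ae_le_eLpNormEssSup (f := a) (μ := μ)] with x hx
  rw [← eLpNorm_exponent_top, ← Lp.enorm_def] at hx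
  exact enorm_le_iff_norm_le.1 hx

variable {p : ℝ≥0∞} [Fact (1 ≤ p)]

/-- Where `a` stays close to a fixed operator `c`, its norm is controlled by testing `mulOp μ p a`
on an almost norming vector of `c`. -/
theorem measure_norm_mulOp_add_lt_eq_zero [SigmaFinite μ] (hp : p ≠ ∞) (a : Lp (E →L[ℂ] E) ∞ μ)
    (c : E →L[ℂ] E) {δ : ℝ} (hδ : 0 < δ) :
    μ {x | ‖a x - c‖ < δ ∧ ‖mulOp μ p a‖ + 3 * δ < ‖a x‖} = 0 := by
  set M := ‖mulOp μ p a‖ with hM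
  have hM0 : 0 ≤ M := norm_nonneg _
  have hp0 : p ≠ 0 := (zero_lt_one.trans_le (Fact.out : 1 ≤ p)).ne'
  have hsm := Lp.stronglyMeasurable a
  by_contra h0
  have hmeas : MeasurableSet {x | ‖a x - c‖ < δ ∧ M + 3 * δ < ‖a x‖} :=
    (measurableSet_lt (hsm.sub stronglyMeasurable_const).norm.measurable measurable_const).inter
      (measurableSet_lt measurable_const hsm.norm.measurable)
  obtain ⟨t, ht, hts, ht0, htop⟩ :=
    Measure.exists_subset_measure_lt_top hmeas (pos_iff_ne_zero.2 h0)
  obtain ⟨x₀, hx₀⟩ := nonempty_of_measure_ne_zero ht0.ne'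
  have hc : M + 2 * δ < ‖c‖ := by
    have h1 := (hts hx₀).1
    have h2 := (hts hx₀).2
    have h3 := norm_sub_norm_le (a x₀) c
    linarith
  obtain ⟨u, hu1, hu⟩ := c.exists_lt_apply_of_lt_opNorm hc
  have hu0 : 0 < ‖u‖ := by
    rw [norm_pos_iff]
    rintro rfl
    rw [map_zero, norm_zero] at hu
    linarith
  let f : Lp E p μ := indicatorConstLp p ht htop.ne u
  have hf : 0 < ‖f‖ := by
    rw [norm_indicatorConstLp hp0 hp]
    have : 0 < μ.real t := ENNReal.toReal_pos ht0.ne' htop.ne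
    positivity
  have hle : ‖((M + δ : ℝ) : ℂ) • f‖ ≤ ‖mulOp μ p a f‖ := by
    refine Lp.norm_le_norm_of_ae_le ?_
    filter_upwards [Lp.coeFn_smul ((M + δ : ℝ) : ℂ) f, mulOp_coe μ p a f,
      indicatorConstLp_coeFn (p := p) (hs := ht) (hμs := htop.ne) (c := u)] with x h1 h2 h3
    have h3' : f x = t.indicator (fun _ => u) x := h3
    rw [h1, h2, Pi.smul_apply, h3']
    by_cases hx : x ∈ t
    · rw [Set.indicator_of_mem hx, norm_smul, Complex.norm_real,
        Real.norm_of_nonneg (by positivity)]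
      have h4 := (a x - c).le_of_opNorm_le (hts hx).1.le u
      have h5 := norm_sub_norm_le (c u) (a x u)
      rw [norm_sub_rev, ← sub_apply] at h5
      nlinarith
    · simp [Set.indicator_of_notMem hx]
  rw [norm_smul, Complex.norm_real, Real.norm_of_nonneg (by positivity)] at hle
  have := hle.trans ((mulOp μ p a).le_opNorm f)
  nlinarith

/-- The multiplication operator has norm at least the essential supremum of `‖a‖`. It suffices to
test on functions `1_Δ u`, as `a` is nearly constant on small sets `Δ`. -/
theorem norm_le_norm_mulOp [SigmaFinite μ] (hp : p ≠ ∞) (a : Lp (E →L[ℂ] E) ∞ μ) :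
    ‖a‖ ≤ ‖mulOp μ p a‖ := by
  have hae : ∀ᵐ x ∂μ, ‖a x‖ ≤ ‖mulOp μ p a‖ := by
    -- The range of `a` is separable, so countably many operators `c` suffice
    obtain ⟨t, -, htc, hdense⟩ :=
      (Lp.stronglyMeasurable a).isSeparable_range.exists_countable_dense_subset
    have hall : ∀ᵐ x ∂μ, ∀ c ∈ t, ∀ n : ℕ,
        ¬(‖a x - c‖ < 1 / ((n : ℝ) + 1) ∧ ‖mulOp μ p a‖ + 3 * (1 / ((n : ℝ) + 1)) < ‖a x‖) := by
      rw [ae_ball_iff htc]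
      intro c _
      rw [ae_all_iff]
      intro n
      exact measure_eq_zero_iff_ae_notMem.1
        (measure_norm_mulOp_add_lt_eq_zero hp a c Nat.one_div_pos_of_nat)
    filter_upwards [hall] with x hx
    by_contra! hlt
    obtain ⟨n, hn⟩ := exists_nat_one_div_lt
      (show 0 < (‖a x‖ - ‖mulOp μ p a‖) / 3 by linarith)
    obtain ⟨c, hct, hc⟩ := Metric.mem_closure_iff.1 (hdense ⟨x, rfl⟩) (1 / ((n : ℝ) + 1))
      Nat.one_div_pos_of_nat
    rw [dist_eq_norm] at hc
    exact hx c hct n ⟨hc, by linarith⟩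
  rw [Lp.norm_def, eLpNorm_exponent_top]
  exact ENNReal.toReal_le_of_le_ofReal (norm_nonneg _) (eLpNormEssSup_le_of_ae_bound hae)

theorem isClosed_multAlg [SigmaFinite μ] [CompleteSpace E] (hp : p ≠ ∞) :
    IsClosed (multAlg E μ p : Set (Lp E p μ →L[ℂ] Lp E p μ)) :=
  (AddMonoidHomClass.antilipschitz_of_bound (mulOp (E := E) μ p) (K := 1) fun a => by
    rw [NNReal.coe_one, one_mul]; exact norm_le_norm_mulOp hp a).isClosed_range
    (mulOp (E := E) μ p).uniformContinuous

theorem memLp_top_indicator_const {F : Type*} [NormedAddCommGroup F] (μ : Measure Ω) {Δ : Set Ω}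
    (hΔ : MeasurableSet Δ) (c : F) : MemLp (Δ.indicator fun _ => c) ∞ μ :=
  (memLp_top_const c).indicator hΔ

variable (p) in
/-- Multiplication by the indicator function of a measurable set. -/
def cut {Δ : Set Ω} (hΔ : MeasurableSet Δ) : Lp E p μ →L[ℂ] Lp E p μ :=
  mulOp μ p ((memLp_top_indicator_const μ hΔ (ContinuousLinearMap.id ℂ E)).toLp _)

theorem cut_coe {Δ : Set Ω} (hΔ : MeasurableSet Δ) (f : Lp E p μ) :
    cut p hΔ f =ᵐ[μ] Δ.indicator f := by
  have hmem := memLp_top_indicator_const μ hΔ (ContinuousLinearMap.id ℂ E)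
  filter_upwards [mulOp_coe μ p (hmem.toLp _) f, hmem.coeFn_toLp] with x h1 h2
  rw [cut, h1, h2]
  by_cases hx : x ∈ Δ
  · rw [Set.indicator_of_mem hx, Set.indicator_of_mem hx]
    rfl
  · rw [Set.indicator_of_notMem hx, Set.indicator_of_notMem hx]
    rfl

theorem apply_cut_of_mem_multAlg {Δ : Set Ω} (hΔ : MeasurableSet Δ) {b : Lp E p μ →L[ℂ] Lp E p μ}
    (hb : b ∈ multAlg E μ p) (f : Lp E p μ) : b (cut p hΔ f) = cut p hΔ (b f) := by
  obtain ⟨a, rfl⟩ := hb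
  refine Lp.ext ?_
  filter_upwards [mulOp_coe μ p a (cut p hΔ f), cut_coe hΔ f, cut_coe hΔ (mulOp μ p a f),
    mulOp_coe μ p a f] with x h1 h2 h3 h4
  rw [h1, h2, h3]
  by_cases hx : x ∈ Δ <;> simp [hx, h4]

theorem enorm_rpow_eq_lintegral {F : Type*} [NormedAddCommGroup F] (hp : p ≠ ∞) (f : Lp F p μ) :
    ‖f‖ₑ ^ p.toReal = ∫⁻ x, ‖f x‖ₑ ^ p.toReal ∂μ := by
  have hp0 : p ≠ 0 := (zero_lt_one.trans_le (Fact.out : 1 ≤ p)).ne'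
  rw [Lp.enorm_def, eLpNorm_eq_lintegral_rpow_enorm_toReal hp0 hp, one_div,
    ENNReal.rpow_inv_rpow (ENNReal.toReal_pos hp0 hp).ne']

theorem enorm_cut_rpow (hp : p ≠ ∞) {Δ : Set Ω} (hΔ : MeasurableSet Δ) (f : Lp E p μ) :
    ‖cut p hΔ f‖ₑ ^ p.toReal = ∫⁻ x in Δ, ‖f x‖ₑ ^ p.toReal ∂μ := by
  have hp0 : p ≠ 0 := (zero_lt_one.trans_le (Fact.out : 1 ≤ p)).ne'
  rw [enorm_rpow_eq_lintegral hp, ← lintegral_indicator hΔ]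
  refine lintegral_congr_ae ?_
  filter_upwards [cut_coe hΔ f] with x hx
  rw [hx]
  by_cases h : x ∈ Δ <;> simp [h, ENNReal.toReal_pos hp0 hp]

/-- The `p`-th power of the norm is additive on functions with essentially disjoint supports. -/
theorem enorm_sum_rpow_of_disjoint {F : Type*} [NormedAddCommGroup F] (hp : p ≠ ∞) {ι : Type*}
    (s : Finset ι) (f : ι → Lp F p μ)
    (h : ∀ i ∈ s, ∀ j ∈ s, i ≠ j → ∀ᵐ x ∂μ, f i x = 0 ∨ f j x = 0) :
    ‖∑ i ∈ s, f i‖ₑ ^ p.toReal = ∑ i ∈ s, ‖f i‖ₑ ^ p.toReal := by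
  have hp0 : p ≠ 0 := (zero_lt_one.trans_le (Fact.out : 1 ≤ p)).ne'
  have hpt := ENNReal.toReal_pos hp0 hp
  simp only [enorm_rpow_eq_lintegral hp]
  rw [← lintegral_finsetSum' s fun i _ => (Lp.aestronglyMeasurable (f i)).enorm.pow_const _]
  have hae : ∀ᵐ x ∂μ, ∀ i ∈ s, ∀ j ∈ s, i ≠ j → f i x = 0 ∨ f j x = 0 := by
    rw [Finset.eventually_all]
    intro i hi
    rw [Finset.eventually_all]
    intro j hj
    by_cases hij : i = j
    · exact .of_forall fun x h => absurd hij h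
    · filter_upwards [h i hi j hj hij] with x hx _ using hx
  refine lintegral_congr_ae ?_
  filter_upwards [hae, coeFn_sum_Lp s f] with x h1 h2
  rw [h2]
  by_cases h3 : ∃ i ∈ s, f i x ≠ 0
  · obtain ⟨i, hi, hne⟩ := h3
    have h4 : ∀ j ∈ s, j ≠ i → f j x = 0 := fun j hj hji =>
      (h1 j hj i hi hji).resolve_right hne
    rw [Finset.sum_eq_single_of_mem i hi h4, Finset.sum_eq_single_of_mem i hi fun j hj hji => by
      simp [h4 j hj hji, hpt]]
  · push Not at h3
    rw [Finset.sum_eq_zero h3, Finset.sum_eq_zero fun i hi => by simp [h3 i hi, hpt]]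
    simp [hpt]

end Multiplication

/-! ### Metrically free actions: the upper bound for the norm -/

section FreeAction

variable {Ω : Type*} [MeasurableSpace Ω] {E : Type*} [NormedAddCommGroup E] [NormedSpace ℂ E]
  {μ : Measure Ω} [SigmaFinite μ] {p : ℝ≥0∞} [Fact (1 ≤ p)] {G : Type*} [Group G] [MulAction G Ω]

/-- `T_g a T_g⁻¹` is multiplication by `x ↦ a(α_g⁻¹(x))`. -/
theorem hat_mem_multAlg (hα : PreservesClass G μ) (g : G) {b : Lp E p μ →L[ℂ] Lp E p μ}
    (hb : b ∈ multAlg E μ p) : hat (weightedComp E p hα) g b ∈ multAlg E μ p := by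
  obtain ⟨a, rfl⟩ := hb
  have hmem : MemLp (fun x => a (g⁻¹ • x)) ∞ μ :=
    memLp_top_of_bound ((Lp.aestronglyMeasurable a).comp_quasiMeasurePreserving (hα g⁻¹)) ‖a‖
      ((hα g⁻¹).ae (ae_norm_le_norm_Lp_top a))
  refine ⟨hmem.toLp _, ?_⟩
  ext1 f
  obtain ⟨φ, rfl⟩ := (weightedComp E p hα g).surjective f
  have e : hat (weightedComp E p hα) g (mulOp μ p a) (weightedComp E p hα g φ) =
      weightedComp E p hα g (mulOp μ p a φ) := by
    rw [hat_apply]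
    congr 2
    exact (weightedComp E p hα g).symm_apply_apply φ
  rw [e]
  refine Lp.ext ?_
  filter_upwards [mulOp_coe μ p (hmem.toLp _) (weightedComp E p hα g φ), hmem.coeFn_toLp,
    weightedComp_coe p hα g φ, weightedComp_coe p hα g (mulOp μ p a φ),
    (hα g⁻¹).ae (mulOp_coe μ p a φ)] with x h1 h2 h3 h4 h5
  rw [h1, h2, h3, h4, h5, map_smul]

theorem weightedComp_cut_eq_zero (hα : PreservesClass G μ) (g : G) {Δ : Set Ω}
    (hΔ : MeasurableSet Δ) (f : Lp E p μ) :
    ∀ᵐ x ∂μ, x ∉ (fun y : Ω => g • y) '' Δ → weightedComp E p hα g (cut p hΔ f) x = 0 := by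
  filter_upwards [weightedComp_coe p hα g (cut p hΔ f), (hα g⁻¹).ae (cut_coe hΔ f)] with x h1 h2 hx
  have : g⁻¹ • x ∉ Δ := fun h => hx ⟨_, h, smul_inv_smul g x⟩
  rw [h1, h2, Set.indicator_of_notMem this, smul_zero]

/-- If the sets `k⁻¹ • Δ`, `k ∈ K`, are essentially disjoint, `u ↦ ∑ T_k⁻¹(u_k)` is isometric, for
the `ℓ^p`-norm, on families of functions supported in `Δ`. -/
theorem enorm_sum_weightedComp_cut_rpow (hα : PreservesClass G μ) (hp : p ≠ ∞) (K : Finset G)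
    {Δ : Set Ω} (hΔ : MeasurableSet Δ)
    (hK : ∀ g ∈ K, ∀ h ∈ K, g ≠ h →
      μ (((fun x : Ω => g⁻¹ • x) '' Δ) ∩ ((fun x : Ω => h⁻¹ • x) '' Δ)) = 0)
    (u : G → Lp E p μ) :
    ‖∑ k ∈ K, weightedComp E p hα k⁻¹ (cut p hΔ (u k))‖ₑ ^ p.toReal =
      ∑ k ∈ K, ∫⁻ x in Δ, ‖u k x‖ₑ ^ p.toReal ∂μ := by
  rw [enorm_sum_rpow_of_disjoint hp]
  · refine Finset.sum_congr rfl fun k _ => ?_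
    rw [← enorm_cut_rpow hp hΔ, ← ofReal_norm, ← ofReal_norm, LinearIsometryEquiv.norm_map]
  · intro g hg h hh hgh
    filter_upwards [measure_eq_zero_iff_ae_notMem.1 (hK g hg h hh hgh),
      weightedComp_cut_eq_zero hα g⁻¹ hΔ (u g), weightedComp_cut_eq_zero hα h⁻¹ hΔ (u h)]
      with x h1 h2 h3
    by_cases hx : x ∈ (fun y : Ω => g⁻¹ • y) '' Δ
    · exact Or.inr (h3 fun hx' => h1 ⟨hx, hx'⟩)
    · exact Or.inl (h2 hx)

/-- The norm of a finitely supported element of `ℓ^p(G, X)`. -/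
theorem enorm_lp_rpow_eq_sum {G X : Type*} [NormedAddCommGroup X] (hp : p ≠ ∞)
    (ξ : lp (fun _ : G => X) p) (K : Finset G) (h : ∀ k ∉ K, ξ k = 0) :
    ‖ξ‖ₑ ^ p.toReal = ∑ k ∈ K, ‖ξ k‖ₑ ^ p.toReal := by
  have hpt := ENNReal.toReal_pos (zero_lt_one.trans_le (Fact.out : 1 ≤ p)).ne' hp
  have e : ∀ y : X, ‖y‖ₑ ^ p.toReal = ENNReal.ofReal (‖y‖ ^ p.toReal) := fun y => by
    rw [← ofReal_norm, ENNReal.ofReal_rpow_of_nonneg (norm_nonneg _) hpt.le]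
  simp only [e]
  rw [← ofReal_norm, ENNReal.ofReal_rpow_of_nonneg (norm_nonneg _) hpt.le,
    lp.norm_rpow_eq_tsum hpt, tsum_eq_sum fun k hk => by
    rw [h k hk, norm_zero, Real.zero_rpow hpt.ne'], ENNReal.ofReal_sum_of_nonneg]
  intro k _
  positivity

/-- The map `u ↦ ∑ T_k⁻¹(u_k)` intertwines the regular representation with the original one. -/
theorem sum_apply_sum_inv {X : Type*} [NormedAddCommGroup X] [NormedSpace ℂ X]
    (T : G →* (X ≃ₗᵢ[ℂ] X)) (s : Finset G) (a : G → X →L[ℂ] X) (F F' : Finset G)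
    (hF' : ∀ k ∈ F, ∀ g ∈ s, k * g⁻¹ ∈ F') (u : G → X) (hu : ∀ k ∉ F, u k = 0) :
    ∑ h ∈ F', T h⁻¹ (∑ g ∈ s, hat T h (a g) (u (h * g))) =
      (∑ g ∈ s, a g * op T g) (∑ k ∈ F, T k⁻¹ (u k)) := by
  simp only [map_sum, sum_apply]
  rw [Finset.sum_comm]
  nth_rewrite 2 [Finset.sum_comm]
  refine Finset.sum_congr rfl fun g hg => ?_
  have e : ∀ h, T h⁻¹ (hat T h (a g) (u (h * g))) =
      (a g * op T g) (T (h * g)⁻¹ (u (h * g))) := by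
    intro h
    simp [hat_apply]
  simp only [e]
  have hmap := Finset.sum_map F' (mulRightEmbedding g) fun k => (a g * op T g) (T k⁻¹ (u k))
  simp only [mulRightEmbedding_apply] at hmap
  rw [← hmap]
  refine (Finset.sum_subset ?_ fun k _ hk => by rw [hu k hk, map_zero, map_zero]).symm
  intro k hk
  exact Finset.mem_map.2 ⟨k * g⁻¹, hF' k hk g hg, by simp⟩

/-- The `ℓ^p` estimate behind the free action: on small sets `Δ` with disjoint translates the
regular representation is a copy of the original operator, and everything is local in `Ω`. -/
theorem sum_enorm_rpow_le (hα : PreservesClass G μ) (hfree : MetricallyFree G μ) (hp : p ≠ ∞)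
    (s : Finset G) (a : G → Lp E p μ →L[ℂ] Lp E p μ) (ha : ∀ g, a g ∈ multAlg E μ p)
    (F F' : Finset G) (hF' : ∀ k ∈ F, ∀ g ∈ s, k * g⁻¹ ∈ F') (u : G → Lp E p μ)
    (hu : ∀ k ∉ F, u k = 0) :
    ∑ h ∈ F', ‖∑ g ∈ s, hat (weightedComp E p hα) h (a g) (u (h * g))‖ₑ ^ p.toReal ≤
      ‖∑ g ∈ s, a g * op (weightedComp E p hα) g‖ₑ ^ p.toReal * ∑ k ∈ F, ‖u k‖ₑ ^ p.toReal := by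
  classical
  have hpt := ENNReal.toReal_pos (zero_lt_one.trans_le (Fact.out : 1 ≤ p)).ne' hp
  set T := weightedComp E p hα with hT
  set b := ∑ g ∈ s, a g * op T g with hb
  set v : G → Lp E p μ := fun h => ∑ g ∈ s, hat T h (a g) (u (h * g)) with hv
  have hmeas : ∀ f : Lp E p μ, Measurable fun x => ‖f x‖ₑ ^ p.toReal := fun f =>
    (Lp.stronglyMeasurable f).enorm.pow_const _
  have hint : ∀ (w : G → Lp E p μ) (K : Finset G) (Δ : Set Ω),
      ∫⁻ x in Δ, ∑ k ∈ K, ‖w k x‖ₑ ^ p.toReal ∂μ =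
        ∑ k ∈ K, ∫⁻ x in Δ, ‖w k x‖ₑ ^ p.toReal ∂μ := fun w K Δ =>
    lintegral_finsetSum K fun k _ => hmeas (w k)
  have hint' : ∀ (w : G → Lp E p μ) (K : Finset G),
      ∫⁻ x, ∑ k ∈ K, ‖w k x‖ₑ ^ p.toReal ∂μ = ∑ k ∈ K, ‖w k‖ₑ ^ p.toReal := fun w K => by
    rw [lintegral_finsetSum K fun k _ => hmeas (w k)]
    exact Finset.sum_congr rfl fun k _ => (enorm_rpow_eq_lintegral hp (w k)).symm
  have hmsum : ∀ (w : G → Lp E p μ) (K : Finset G),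
      Measurable fun x => ∑ k ∈ K, ‖w k x‖ₑ ^ p.toReal := fun w K =>
    Finset.measurable_fun_sum K fun k _ => hmeas (w k)
  have hbtop : ‖b‖ₑ ^ p.toReal ≠ ∞ := ENNReal.rpow_ne_top_of_nonneg hpt.le enorm_ne_top
  have hae : ∀ᵐ x ∂μ, ∑ h ∈ F', ‖v h x‖ₑ ^ p.toReal ≤
      ‖b‖ₑ ^ p.toReal * ∑ k ∈ F, ‖u k x‖ₑ ^ p.toReal := by
    refine ae_le_of_exists_setLIntegral_le (hmsum v F') ((hmsum u F).const_mul _) ?_ ?_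
    · rw [lintegral_const_mul _ (hmsum u F), hint']
      refine ENNReal.mul_ne_top hbtop (ENNReal.sum_ne_top.2 fun k _ => ?_)
      exact ENNReal.rpow_ne_top_of_nonneg hpt.le enorm_ne_top
    · intro Δ hΔ hΔ0
      obtain ⟨Δ', hm, hpos, hsub, hdisj⟩ := hfree ((F ∪ F').image fun k => k⁻¹) Δ hΔ hΔ0
      have hdisj' : ∀ g ∈ F ∪ F', ∀ h ∈ F ∪ F', g ≠ h →
          μ (((fun x : Ω => g⁻¹ • x) '' Δ') ∩ ((fun x : Ω => h⁻¹ • x) '' Δ')) = 0 :=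
        fun g hg h hh hgh => hdisj _ (Finset.mem_image_of_mem _ hg) _
          (Finset.mem_image_of_mem _ hh) (inv_injective.ne hgh)
      refine ⟨Δ', hsub, hm, hpos, ?_⟩
      rw [lintegral_const_mul _ (hmsum u F), hint, hint,
        ← enorm_sum_weightedComp_cut_rpow hα hp F hm (fun g hg h hh => hdisj' g
          (Finset.mem_union_left _ hg) h (Finset.mem_union_left _ hh)),
        ← enorm_sum_weightedComp_cut_rpow hα hp F' hm (fun g hg h hh => hdisj' g
          (Finset.mem_union_right _ hg) h (Finset.mem_union_right _ hh)),
        ← ENNReal.mul_rpow_of_nonneg _ _ hpt.le]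
      refine ENNReal.rpow_le_rpow ?_ hpt.le
      have e : ∀ h, cut p hm (v h) = ∑ g ∈ s, hat T h (a g) (cut p hm (u (h * g))) := fun h => by
        rw [hv, map_sum]
        exact Finset.sum_congr rfl fun g _ =>
          (apply_cut_of_mem_multAlg hm (hat_mem_multAlg hα h (ha g)) _).symm
      simp only [e]
      rw [sum_apply_sum_inv T s a F F' hF' (fun k => cut p hm (u k)) fun k hk => by
        rw [hu k hk, map_zero]]
      exact ContinuousLinearMap.le_opENorm b _
  rw [← hint' v, ← hint' u, ← lintegral_const_mul _ (hmsum u F)]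
  exact lintegral_mono_ae hae

/-- For a metrically free action, the regular representation does not increase norms. -/
theorem norm_regSum_le (hα : PreservesClass G μ) (hfree : MetricallyFree G μ) (hp : p ≠ ∞)
    (s : Finset G) (a : G → Lp E p μ →L[ℂ] Lp E p μ) (ha : ∀ g, a g ∈ multAlg E μ p) :
    ‖regSum p (weightedComp E p hα) s a‖ ≤ ‖∑ g ∈ s, a g * op (weightedComp E p hα) g‖ := by
  classical
  have hpt := ENNReal.toReal_pos (zero_lt_one.trans_le (Fact.out : 1 ≤ p)).ne' hp
  set T := weightedComp E p hα with hT
  set b := ∑ g ∈ s, a g * op T g with hb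
  refine ContinuousLinearMap.opNorm_le_bound _ (norm_nonneg _) fun ξ => ?_
  have hcl : IsClosed {ξ : lp (fun _ : G => Lp E p μ) p | ‖regSum p T s a ξ‖ ≤ ‖b‖ * ‖ξ‖} :=
    isClosed_le (regSum p T s a).continuous.norm (continuous_const.mul continuous_norm)
  refine hcl.mem_of_tendsto (lp.hasSum_single hp ξ) (.of_forall fun F => ?_)
  set η := ∑ k ∈ F, lp.single p k (ξ k) with hη
  change ‖regSum p T s a η‖ ≤ ‖b‖ * ‖η‖
  have hη0 : ∀ k ∉ F, η k = 0 := fun k hk => by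
    rw [hη, coe_sum_lp]
    refine Finset.sum_eq_zero fun i hi => lp.single_apply_ne _ _ _ ?_
    rintro rfl
    exact hk hi
  -- `R(b)` maps functions supported in `F` to functions supported in `F s⁻¹`.
  let F' : Finset G := (F ×ˢ s).image fun q => q.1 * q.2⁻¹
  have hF' : ∀ k ∈ F, ∀ g ∈ s, k * g⁻¹ ∈ F' := fun k hk g hg =>
    Finset.mem_image.2 ⟨(k, g), Finset.mem_product.2 ⟨hk, hg⟩, rfl⟩
  have hR0 : ∀ h ∉ F', regSum p T s a η h = 0 := fun h hh => by
    rw [regSum_apply]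
    refine Finset.sum_eq_zero fun g hg => ?_
    rw [hη0 (h * g) fun hk => hh (by simpa using hF' _ hk g hg), map_zero]
  have key := sum_enorm_rpow_le hα hfree hp s a ha F F' hF' η hη0
  simp only [← hT, ← hb, ← regSum_apply] at key
  rw [← enorm_lp_rpow_eq_sum hp _ F' hR0, ← enorm_lp_rpow_eq_sum hp _ F hη0,
    ← ENNReal.mul_rpow_of_nonneg _ _ hpt.le, ENNReal.rpow_le_rpow_iff hpt] at key
  rw [← ofReal_norm, ← ofReal_norm, ← ofReal_norm, ← ENNReal.ofReal_mul (norm_nonneg _)] at key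
  exact (ENNReal.ofReal_le_ofReal_iff (by positivity)).1 key

end FreeAction

end AutAlg

end

theorem theorem3p4 {Ω : Type*} [MeasurableSpace Ω] (μ : Measure Ω) [SigmaFinite μ]
    {E : Type*} [NormedAddCommGroup E] [NormedSpace ℂ E] [CompleteSpace E]
    {G : Type*} [Group G] [MulAction G Ω] (hα : AutAlg.PreservesClass G μ)
    (p : ℝ≥0∞) [Fact (1 ≤ p)] (hp1 : 1 < p) (hp : p < ∞)
    (hG : AutAlg.IsAmenable G) (hfree : AutAlg.MetricallyFree G μ) :
    (∃ Φ : AutAlg.B (AutAlg.multAlg E μ p) (AutAlg.weightedComp E p hα) ≃ₐ[ℂ]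
          AutAlg.B (AutAlg.barAlg p (AutAlg.multAlg E μ p) (AutAlg.weightedComp E p hα))
            (AutAlg.V (G := G) (Lp E p μ) p),
        Isometry Φ ∧
        (∀ a (ha : a ∈ AutAlg.multAlg E μ p),
          Φ ⟨a, AutAlg.coeff_mem _ _ ha⟩ =
            ⟨AutAlg.bar p (AutAlg.weightedComp E p hα) a,
              AutAlg.coeff_mem _ _ (AutAlg.bar_mem p _ _ ha)⟩) ∧
        ∀ g : G,
          Φ ⟨AutAlg.op (AutAlg.weightedComp E p hα) g, AutAlg.op_mem _ _ g⟩ =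
            ⟨AutAlg.op (AutAlg.V (Lp E p μ) p) g, AutAlg.op_mem _ _ g⟩) ∧
    AutAlg.PropStar (AutAlg.multAlg E μ p) (AutAlg.weightedComp E p hα) ∧
    AutAlg.PropStarStar (AutAlg.multAlg E μ p) (AutAlg.weightedComp E p hα) ∧
    AutAlg.CharInvariant (AutAlg.multAlg E μ p) (AutAlg.weightedComp E p hα) := by
  refine AutAlg.regular_representation p _ _ hp.ne (fun g _ => AutAlg.hat_mem_multAlg hα g)
    (AutAlg.isClosed_multAlg hp.ne) fun a => le_antisymm ?_ ?_
  · exact AutAlg.norm_sum_le_norm_regSum p hG hp.ne _ _ _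
  · exact AutAlg.norm_regSum_le hα hfree hp.ne _ _ fun g => (a g).2
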